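/- Fix $\alpha\in[0,1]$, $x_0>0$, $c>0$, $\epsilon>0$, $C>0$. **Model.** Let $\sigma:[0,\infty)\times(0,\infty)\to(0,\infty)$ be continuous, such that for every $L>0$ there is a constant $C_L$ with $|\sigma(t,x)-\sigma(t,y)|\le C_L|x-y|^{1/2}$ for $t\in[0,L]$, $x,y\in[L^{-1},L]$, bounded on $[0,\infty)\times(0,1]$, and piecewise monotone in time: there are $0=\tau_0<\tau_1<\cdots\to\infty$ such that on each $[\tau_n,\tau_{n+1}]$ either $\sigma(\cdot,x)$ is (weakly) increasing for all $x>0$ or $\sigma(\cdot,x)$ is (weakly) decreasing for all $x>0$. Let $X$ be a nonnegative continuous weak solution of $dX_t=\sigma(t,X_t)\,dW_t$, $X_0=x_0$, under a probability $Q$, absorbed at $0$ should it reach $0$ (equivalently, a nonnegative continuous solution of the associated local martingale problem), and let $$C^{\sigma}(T,K)=\mathbb E^Q[(X_T-K)^+]+\alpha\,(x_0-\mathbb E^Q[X_T]),\qquad T\ge 0,\ K>0 .$$ Consider the space of functions that are continuous on $[0,\infty)\times(0,\infty)$ and of class $C^{1,2}$ on $(0,\infty)\times(0,\infty)$, with the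 topology of uniform convergence of $f$ on compact subsets of $[0,\infty)\times(0,\infty)$ and of $\partial_tf,\partial_xf,\partial_{xx}f$ on compact subsets of $(0,\infty)\times(0,\infty)$. Let $\mathcal X$ be the set of those $f$ in this space that are of the form $f=C^\sigma$ with $\sigma$ as above and satisfy $\partial_{xx}f>0$ on $(0,\infty)\times(0,\infty)$; it carries the subspace topology and its Borel $\sigma$-algebra. **Bubble detection function.** Define $F:\mathcal X\to\{0,1\}$ as follows. If $\alpha<1$, then $F(f)=1$ if and only if there is $t\ge0$ such that $\lim_{x\to0}f(T,x)<x_0$ for all $T\ge t$. If $\alpha=1$, then $F(f)=1$ if and only if there is $t\in(0,\infty)\setminus B^f$ with $\int_c^\infty x\,\frac{\partial_{xx}f(t,x)}{\partial_tf(t,x)}\,dx<\infty$; here, with $\sigma_f=\sqrt{2\,\partial_tf/\partial_{xx}f}$, $B^f$ is the set of those $T>0$ at which the function-valued map $t\mapsto\sigma_f(t,\cdot)$ has a strict local maximum for the pointwise order, i.e. for all $s\ne T$ close enough to $T$ one has $\sigma_f(s,x)\le\sigma_f(T,x)$ for all $x>0$ and $\sigma_f(s,\cdot)\neq\sigma_f(T,\cdot)$.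 **Observations.** Let $A=[0,\infty)\times(0,\epsilon]$ if $\alpha<1$ and $A=[0,\infty)\times[C,\infty)$ if $\alpha=1$, and let $(T_n,K_n)_{n\ge1}$ be a sequence in $[0,\infty)\times(0,\infty)$ whose closure contains $A$ (for instance a sequence in $A$ that is dense in $A$). Let $\mu,\nu$ be probability measures on $\mathcal X$ such that $$\nu\big(\{f\in\mathcal X:\ f(T_i,K_i)=g(T_i,K_i)\ \text{for all } i\in\mathbb N\}\big)>0\qquad\text{for every } g\in\operatorname{supp}(\mu).$$ For $c^n\in\mathbb R^n$ put $S_n(c^n)=\{f\in\mathcal X: f(T_i,K_i)=c^n_i,\ i=1,\dots,n\}$ and $$F^n(c^n)=\begin{cases}\dfrac1{\nu(S_n(c^n))}\displaystyle\int_{S_n(c^n)}F\,d\nu&\text{if }\nu(S_n(c^n))>0,\\[2mm]0&\text{otherwise.}\end{cases}$$ **Claim.** $F$ is measurable, each $F^n:\mathbb R^n\to\mathbb R$ is measurable with values in $[0,1]$, and for every $p\in[1,\infty)$ the functions $g\mapsto|F^n(g(T_1,K_1),\dots,g(T_n,K_n))-F(g)|^p$ are $\mu$-integrable with $$\int_{\mathcal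 X}\big|F^n(g(T_1,K_1),\dots,g(T_n,K_n))-F(g)\big|^p\,d\mu(g)\longrightarrow0\qquad(n\to\infty).$$ -/

import Mathlib

open MeasureTheory ProbabilityTheory Filter Topology Set
open scoped NNReal ENNReal

namespace BubbleDetection

noncomputable section

/-- Extension by zero to the whole line of a function given on `(0, ∞)`. -/
def onPos (g : Ioi (0 : ℝ) → ℝ) : ℝ → ℝ := by
  classical exact fun y => if h : 0 < y then g ⟨y, h⟩ else 0

/-- The space of functions `f` of maturity `t ∈ [0, ∞)` and strike `x ∈ (0, ∞)` that are continuous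
on `[0, ∞) × (0, ∞)` and of class `C^{1,2}` on `(0, ∞) × (0, ∞)`. The derivatives `∂_t f`, `∂_x f`
and `∂_{xx} f` (which `f` determines) are recorded as continuous functions. -/
structure PriceSurface where
  val : C(ℝ≥0 × Ioi (0 : ℝ), ℝ)
  dt : C(Ioi (0 : ℝ) × Ioi (0 : ℝ), ℝ)
  dx : C(Ioi (0 : ℝ) × Ioi (0 : ℝ), ℝ)
  dxx : C(Ioi (0 : ℝ) × Ioi (0 : ℝ), ℝ)
  hasDerivAt_t : ∀ t x : Ioi (0 : ℝ),
    HasDerivAt (fun s : ℝ => val (s.toNNReal, x)) (dt (t, x)) t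
  hasDerivAt_x : ∀ t x : Ioi (0 : ℝ),
    HasDerivAt (onPos fun y => val ((t : ℝ).toNNReal, y)) (dx (t, x)) x
  hasDerivAt_xx : ∀ t x : Ioi (0 : ℝ),
    HasDerivAt (onPos fun y => dx (t, y)) (dxx (t, x)) x

/-- The Fréchet topology: uniform convergence of `f` on the compact subsets of
`[0, ∞) × (0, ∞)` and of `∂_t f`, `∂_x f`, `∂_{xx} f` on the compact subsets of
`(0, ∞) × (0, ∞)`. (The topology of each `C(·, ℝ)` is that of locally uniform convergence.) -/
instance : TopologicalSpace PriceSurface :=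
  TopologicalSpace.induced (fun f => (f.val, f.dt, f.dx, f.dxx)) inferInstance

instance : MeasurableSpace PriceSurface := borel PriceSurface

instance : BorelSpace PriceSurface := ⟨rfl⟩

/-- The standing assumption on a local volatility function `σ : [0, ∞) × (0, ∞) → (0, ∞)`;
the values of `σ` elsewhere play no role. -/
structure IsAdmissibleVol (σ : ℝ → ℝ → ℝ) : Prop where
  pos : ∀ t x, 0 ≤ t → 0 < x → 0 < σ t x
  continuousOn : ContinuousOn (fun p : ℝ × ℝ => σ p.1 p.2) (Ici 0 ×ˢ Ioi 0)
  holder : ∀ L : ℝ, 0 < L → ∃ C : ℝ, 0 ≤ C ∧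
    ∀ t ∈ Icc 0 L, ∀ x ∈ Icc L⁻¹ L, ∀ y ∈ Icc L⁻¹ L,
      |σ t x - σ t y| ≤ C * |x - y| ^ (1 / 2 : ℝ)
  bounded_near_zero : ∃ A : ℝ, 0 ≤ A ∧ ∀ t x, 0 ≤ t → x ∈ Ioc (0 : ℝ) 1 → σ t x ≤ A

/-- There is a partition `0 = τ₀ < τ₁ < ⋯ → ∞` of the time axis such that on each `[τₙ, τₙ₊₁]`
either all the functions `σ(·, x)` are increasing or all are decreasing (in the weak sense). -/
def IsPiecewiseMonotoneInTime (σ : ℝ → ℝ → ℝ) : Prop :=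
  ∃ τ : ℕ → ℝ, τ 0 = 0 ∧ StrictMono τ ∧ Tendsto τ atTop atTop ∧
    ∀ n, (∀ x, 0 < x → MonotoneOn (fun t => σ t x) (Icc (τ n) (τ (n + 1)))) ∨
      (∀ x, 0 < x → AntitoneOn (fun t => σ t x) (Icc (τ n) (τ (n + 1))))

/-- `½ σ(s,y)² φ''(y)` for `y > 0`, and `0` for `y ≤ 0` (so that the process is absorbed at `0`
should it ever get there). -/
def generator (σ : ℝ → ℝ → ℝ) (φ : ℝ → ℝ) (s y : ℝ) : ℝ := by
  classical exact if 0 < y then σ s y ^ 2 / 2 * iteratedDeriv 2 φ y else 0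

/-- `X` is, under `Q`, a nonnegative continuous (weak) solution of
`dX_t = σ(t, X_t) dW_t`, `X_0 = x₀`, absorbed at `0` should it get there: it solves the local
martingale problem of Stroock and Varadhan, that is, for every `φ` of class `C²` the process
`φ(X_t) - φ(x₀) - ∫_0^t ½ σ(s, X_s)² φ''(X_s) ds` is a local martingale. -/
structure IsLocalVolModel {Ω : Type*} {mΩ : MeasurableSpace Ω} (σ : ℝ → ℝ → ℝ) (x₀ : ℝ)
    (Q : Measure Ω) (ℱ : Filtration ℝ≥0 mΩ) (X : ℝ≥0 → Ω → ℝ) : Prop where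
  adapted : StronglyAdapted ℱ X
  continuous : ∀ ω, Continuous fun t => X t ω
  nonneg : ∀ t ω, 0 ≤ X t ω
  initial : ∀ ω, X 0 ω = x₀
  localMartingale : ∀ φ : ℝ → ℝ, ContDiff ℝ 2 φ →
    Locally (fun M : ℝ≥0 → Ω → ℝ => Martingale M ℱ Q) ℱ
      (fun t ω => φ (X t ω) - φ x₀
        - ∫ s in (0 : ℝ)..(t : ℝ), generator σ φ s (X s.toNNReal ω)) Q

/-- The call price `E[(X_T - K)⁺] + α (X_0 - E[X_T])` with collateral requirement `α`. -/
def callPrice {Ω : Type*} {mΩ : MeasurableSpace Ω} (α x₀ : ℝ) (Q : Measure Ω)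
    (X : ℝ≥0 → Ω → ℝ) (T : ℝ≥0) (K : ℝ) : ℝ :=
  (∫ ω, max (X T ω - K) 0 ∂Q) + α * (x₀ - ∫ ω, X T ω ∂Q)

/-- `f` is the surface `C^σ` of call prices in the local volatility model with volatility `σ`. -/
def IsCallSurface (α x₀ : ℝ) (σ : ℝ → ℝ → ℝ) (f : PriceSurface) : Prop :=
  ∃ (Ω : Type) (mΩ : MeasurableSpace Ω) (Q : Measure Ω) (ℱ : Filtration ℝ≥0 mΩ)
    (X : ℝ≥0 → Ω → ℝ), IsProbabilityMeasure Q ∧ IsLocalVolModel σ x₀ Q ℱ X ∧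
      ∀ (T : ℝ≥0) (K : Ioi (0 : ℝ)), f.val (T, K) = callPrice α x₀ Q X T K

/-- The set `𝒳` of call price surfaces `C^σ`, for `σ` admissible and piecewise monotone in time,
with `∂_{KK} C^σ > 0` on `(0, ∞) × (0, ∞)`. -/
def callSurfaces (α x₀ : ℝ) : Set PriceSurface :=
  {f | (∃ σ : ℝ → ℝ → ℝ, IsAdmissibleVol σ ∧ IsPiecewiseMonotoneInTime σ ∧
      IsCallSurface α x₀ σ f) ∧ ∀ T K : Ioi (0 : ℝ), 0 < f.dxx (T, K)}

/-- The volatility `√(2 ∂_t f / ∂_{xx} f)` implied by Dupire's equation, as a function of the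
strike, at maturity `t`. -/
def impliedVol (f : PriceSurface) (t : Ioi (0 : ℝ)) : Ioi (0 : ℝ) → ℝ :=
  fun x => √(2 * f.dt (t, x) / f.dxx (t, x))

/-- The maturities at which the function-valued map `t ↦ impliedVol f t` has a strict local maximum
for the pointwise order: for `s ≠ T` near `T`, `impliedVol f s x ≤ impliedVol f T x` for all `x`,
with strict inequality for at least one `x` (this is what `<` means for functions). -/
def localMaxTimes (f : PriceSurface) : Set (Ioi (0 : ℝ)) :=
  {T | ∀ᶠ s in 𝓝[≠] T, impliedVol f s < impliedVol f T}

/-- Bubble criterion for `α < 1`: for some `t ≥ 0`, `lim_{x → 0} f(T,x) < x₀` for all `T ≥ t`. -/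
def BubbleAtZero (x₀ : ℝ) (f : PriceSurface) : Prop :=
  ∃ t : ℝ≥0, ∀ T : ℝ≥0, t ≤ T →
    ∃ l : ℝ, Tendsto (onPos fun x => f.val (T, x)) (𝓝[>] 0) (𝓝 l) ∧ l < x₀

/-- Bubble criterion for `α = 1`: for some `t > 0` that is not a time of local maximum,
`∫_c^∞ x ∂_{xx} f(t,x) / ∂_t f(t,x) dx < ∞`. -/
def BubbleAtInfinity (c : ℝ) (f : PriceSurface) : Prop :=
  ∃ t : Ioi (0 : ℝ), t ∉ localMaxTimes f ∧
    ∫⁻ x in Ioi c, ENNReal.ofReal (onPos (fun y => y * f.dxx (t, y) / f.dt (t, y)) x) < ⊤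

/-- The bubble detection function `F : 𝒳 → {0, 1}`. -/
def bubbleIndicator (α x₀ c : ℝ) (f : callSurfaces α x₀) : ℝ := by
  classical exact
    if α < 1 then (if BubbleAtZero x₀ f.1 then 1 else 0)
    else (if BubbleAtInfinity c f.1 then 1 else 0)

/-- The set of maturities and strikes: `[0, ∞) × (0, ε]` if `α < 1`, and `[0, ∞) × [C, ∞)` if
`α = 1`. -/
def observationSet (α ε C : ℝ) : Set (ℝ≥0 × Ioi (0 : ℝ)) :=
  {p | (α < 1 ∧ (p.2 : ℝ) ≤ ε) ∨ (α = 1 ∧ C ≤ (p.2 : ℝ))}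

/-- The surfaces in `𝒳` whose first `n` observed prices are `c₁, …, cₙ`. -/
def matchingSurfaces {α x₀ : ℝ} (P : ℕ → ℝ≥0 × Ioi (0 : ℝ)) (n : ℕ) (c : Fin n → ℝ) :
    Set (callSurfaces α x₀) :=
  {f | ∀ i : Fin n, f.1.val (P i) = c i}

/-- The function `Fⁿ : ℝⁿ → [0, 1]`: the `ν`-average of `F` over the surfaces that match the first
`n` observed prices (and `0` if these surfaces have `ν`-mass zero). -/
def averagedIndicator {α x₀ : ℝ} (F : callSurfaces α x₀ → ℝ) (ν : Measure (callSurfaces α x₀))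
    (P : ℕ → ℝ≥0 × Ioi (0 : ℝ)) (n : ℕ) (c : Fin n → ℝ) : ℝ := by
  classical exact
    if 0 < ν (matchingSurfaces P n c) then
      (ν (matchingSurfaces P n c)).toReal⁻¹ * ∫ f in matchingSurfaces P n c, F f ∂ν
    else 0

end

end BubbleDetection

/-! The averages `Fn` converge for an elementary reason. The sets of surfaces matching the first `n`
prices of `g` decrease to the set matching all of them. That set has positive `ν`-mass for `g` in
the support of `μ`, so continuity from above gives convergence of the averages to the mean of `F`
over it (`tendsto_averagedIndicator`). The limit is `F g` as soon as `F` is determined by the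
observed prices. Bounded convergence then yields the limit in every `L^p`. What remains is to show
that `F` is measurable and depends only on the prices on `observationSet` (`bubbleIndicator_congr`).
Both follow by rewriting each bubble criterion as a countable condition on those prices.

For `α < 1`: since `(x - K)⁺ = x - min x K`, the price at strike `K → 0` increases to `(1 - α)
E[X_T] + α x₀`, which is nonincreasing in `T` because `X` is a supermartingale. It is therefore
enough to look at integer maturities, strikes `1 / (k + 1)` and rational levels
(`bubbleAtZero_iff`).

For `α = 1`: Dupire's equation (`dupire`) identifies `impliedVol f` with the model volatility `σ`,
so the integrand of the criterion is `2x / σ²`. The set `localMaxTimes` involves all strikes, also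
unobserved ones, and has to be eliminated. Piecewise monotonicity does this: near a time that is not
a strict local maximum there is an interval on which `σ` is at least as large, and conversely every
interval contains a rational time that is not a strict local maximum. Hence the criterion says that
the tail integral is finite at all rational times of some rational interval, and the cutoff of that
integral may be any positive number (`bubbleAtInfinity_iff`). -/

namespace BubbleDetection

noncomputable section

/-! ### Bounded concave test functions and the diffusion rate -/

/-- The function `φ` with `φ 0 = 0`, `φ'' = -ρ` and `φ' b = 0`. -/
def concaveTest (ρ : ℝ → ℝ) (b x : ℝ) : ℝ :=
  (∫ y in (0 : ℝ)..x, y * ρ y) + x * ∫ y in x..b, ρ y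

lemma hasDerivAt_integral_left {ρ : ℝ → ℝ} (hρ : Continuous ρ) (b x : ℝ) :
    HasDerivAt (fun x => ∫ y in x..b, ρ y) (-ρ x) x :=
  intervalIntegral.integral_hasDerivAt_left (hρ.intervalIntegrable _ _)
    (hρ.stronglyMeasurableAtFilter _ _) hρ.continuousAt

lemma hasDerivAt_concaveTest {ρ : ℝ → ℝ} (hρ : Continuous ρ) (b x : ℝ) :
    HasDerivAt (concaveTest ρ b) (∫ y in x..b, ρ y) x := by
  have hc : Continuous fun y => y * ρ y := continuous_id.mul hρ
  have h1 : HasDerivAt (fun x => ∫ y in (0 : ℝ)..x, y * ρ y) (x * ρ x) x :=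
    intervalIntegral.integral_hasDerivAt_right (hc.intervalIntegrable _ _)
      (hc.stronglyMeasurableAtFilter _ _) hc.continuousAt
  have h2 := h1.add ((hasDerivAt_id x).mul (hasDerivAt_integral_left hρ b x))
  refine h2.congr_deriv ?_
  simp only [id]
  ring

lemma deriv_concaveTest {ρ : ℝ → ℝ} (hρ : Continuous ρ) (b : ℝ) :
    deriv (concaveTest ρ b) = fun x => ∫ y in x..b, ρ y :=
  funext fun x => (hasDerivAt_concaveTest hρ b x).deriv

lemma iteratedDeriv_two_concaveTest {ρ : ℝ → ℝ} (hρ : Continuous ρ) (b : ℝ) :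
    iteratedDeriv 2 (concaveTest ρ b) = fun x => -ρ x := by
  rw [iteratedDeriv_succ, iteratedDeriv_one, deriv_concaveTest hρ]
  exact funext fun x => (hasDerivAt_integral_left hρ b x).deriv

lemma contDiff_concaveTest {ρ : ℝ → ℝ} (hρ : Continuous ρ) (b : ℝ) :
    ContDiff ℝ 2 (concaveTest ρ b) := by
  rw [show (2 : WithTop ℕ∞) = 1 + 1 from rfl, contDiff_succ_iff_deriv]
  refine ⟨fun x => (hasDerivAt_concaveTest hρ b x).differentiableAt, by simp, ?_⟩
  rw [contDiff_one_iff_deriv, deriv_concaveTest hρ]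
  refine ⟨fun x => (hasDerivAt_integral_left hρ b x).differentiableAt, ?_⟩
  rw [show deriv (fun x => ∫ y in x..b, ρ y) = fun x => -ρ x from
    funext fun x => (hasDerivAt_integral_left hρ b x).deriv]
  exact hρ.neg

/-- As a superposition of the functions `min · y`, the test function turns expectations into
weighted integrals of truncated means. For `ρ ≥ 0` it is a smooth substitute for the concave
function `min · K`. -/
lemma concaveTest_eq {ρ : ℝ → ℝ} (hρ : Continuous ρ) {b : ℝ} (hb : ∀ y, b ≤ y → ρ y = 0) {x : ℝ}
    (hx : 0 ≤ x) : concaveTest ρ b x = ∫ y in (0 : ℝ)..b, ρ y * min x y := by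
  have hc : Continuous fun y => ρ y * min x y := hρ.mul (continuous_const.min continuous_id)
  rw [← intervalIntegral.integral_add_adjacent_intervals (hc.intervalIntegrable 0 x)
    (hc.intervalIntegrable x b), concaveTest]
  congr 1
  · refine intervalIntegral.integral_congr fun y hy => ?_
    rw [uIcc_of_le hx] at hy
    simp [min_eq_right hy.2, mul_comm]
  · rw [← intervalIntegral.integral_const_mul]
    refine intervalIntegral.integral_congr fun y hy => ?_
    rcases le_total x y with h | h
    · simp [min_eq_left h, mul_comm]
    -- If `b < x` the integral from `x` to `b` runs backwards, over points where `ρ` vanishes.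
    · rcases mem_uIcc.1 hy with h' | h'
      · simp [le_antisymm h h'.1, mul_comm]
      · simp [hb y h'.1]

lemma abs_concaveTest_le {ρ : ℝ → ℝ} (hρ : Continuous ρ) {b : ℝ} (hb0 : 0 ≤ b)
    (hb : ∀ y, b ≤ y → ρ y = 0) :
    ∃ B, ∀ x, 0 ≤ x → |concaveTest ρ b x| ≤ B := by
  obtain ⟨B, hB⟩ := isCompact_Icc.exists_bound_of_continuousOn (s := Icc 0 b) hρ.continuousOn
  refine ⟨B * b * |b - 0|, fun x hx => ?_⟩
  rw [concaveTest_eq hρ hb hx, ← Real.norm_eq_abs]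
  refine intervalIntegral.norm_integral_le_of_norm_le_const fun y hy => ?_
  rw [uIoc_of_le hb0] at hy
  rw [norm_mul]
  have h1 := hB y ⟨hy.1.le, hy.2⟩
  have h2 : ‖min x y‖ ≤ b := by
    rw [Real.norm_eq_abs, abs_of_nonneg (le_min hx hy.1.le)]
    exact (min_le_right _ _).trans hy.2
  exact mul_le_mul h1 h2 (norm_nonneg _) ((norm_nonneg _).trans h1)

/-- `½ σ(s,y)² ρ(y)` for `s ≥ 0`, `y ≥ a`, extended continuously when `ρ` vanishes on `(-∞, a]`. -/
def diffusionRate (σ : ℝ → ℝ → ℝ) (ρ : ℝ → ℝ) (a s y : ℝ) : ℝ :=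
  σ (max s 0) (max y a) ^ 2 / 2 * ρ y

lemma continuous_diffusionRate {σ : ℝ → ℝ → ℝ}
    (hσ : ContinuousOn (fun p : ℝ × ℝ => σ p.1 p.2) (Ici 0 ×ˢ Ioi 0))
    {ρ : ℝ → ℝ} (hρ : Continuous ρ) {a : ℝ} (ha : 0 < a) :
    Continuous fun p : ℝ × ℝ => diffusionRate σ ρ a p.1 p.2 := by
  have h1 : Continuous fun p : ℝ × ℝ => σ (max p.1 0) (max p.2 a) :=
    hσ.comp_continuous (f := fun p : ℝ × ℝ => (max p.1 0, max p.2 a)) (by fun_prop)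
      fun p => ⟨le_max_right p.1 0, ha.trans_le (le_max_right p.2 a)⟩
  exact ((h1.pow 2).div_const 2).mul (hρ.comp continuous_snd)

lemma exists_bound_diffusionRate {σ : ℝ → ℝ → ℝ}
    (hσ : ContinuousOn (fun p : ℝ × ℝ => σ p.1 p.2) (Ici 0 ×ˢ Ioi 0))
    {ρ : ℝ → ℝ} (hρ : Continuous ρ) {a b : ℝ} (ha : 0 < a) (hρa : ∀ y, y ≤ a → ρ y = 0)
    (hρb : ∀ y, b ≤ y → ρ y = 0) (T : ℝ) :
    ∃ B, 0 ≤ B ∧ ∀ s ∈ Icc 0 T, ∀ y, |diffusionRate σ ρ a s y| ≤ B := by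
  obtain ⟨B, hB⟩ := (isCompact_Icc.prod isCompact_Icc).exists_bound_of_continuousOn
    (s := Icc 0 T ×ˢ Icc a b) (continuous_diffusionRate hσ hρ ha).continuousOn
  refine ⟨max B 0, le_max_right _ _, fun s hs y => ?_⟩
  by_cases h1 : y ≤ a
  · simp [diffusionRate, hρa y h1]
  by_cases h2 : b ≤ y
  · simp [diffusionRate, hρb y h2]
  push Not at h1 h2
  exact (hB (s, y) ⟨hs, h1.le, h2.le⟩).trans (le_max_left _ _)

lemma generator_concaveTest (σ : ℝ → ℝ → ℝ) {ρ : ℝ → ℝ} (hρ : Continuous ρ) {a : ℝ} (ha : 0 < a)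
    (hρa : ∀ y, y ≤ a → ρ y = 0) (b : ℝ) {s : ℝ} (hs : 0 ≤ s) (y : ℝ) :
    generator σ (concaveTest ρ b) s y = -diffusionRate σ ρ a s y := by
  rw [generator, iteratedDeriv_two_concaveTest hρ, diffusionRate, max_eq_left hs]
  rcases le_or_gt y a with h | h
  · simp [hρa y h]
  · simp [ha.trans h, max_eq_left h.le]

/-! ### Dynkin's formula from the local martingale problem -/

section Dynkin

variable {Ω : Type*} {mΩ : MeasurableSpace Ω}

/-- A local martingale that is bounded up to time `T` has constant expectation there: the stopped
processes do, and bounded convergence removes the localization. -/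
lemma integral_eq_zero_of_locally_martingale {Q : Measure Ω} [IsProbabilityMeasure Q]
    {ℱ : Filtration ℝ≥0 mΩ} {M : ℝ≥0 → Ω → ℝ}
    (hM : Locally (fun M : ℝ≥0 → Ω → ℝ => Martingale M ℱ Q) ℱ M Q) (h0 : ∀ ω, M 0 ω = 0)
    (T : ℝ≥0) {B : ℝ} (hB : ∀ t ≤ T, ∀ ω, |M t ω| ≤ B) : ∫ ω, M T ω ∂Q = 0 := by
  obtain ⟨τ, hτ, hM⟩ := hM
  set Y : ℕ → ℝ≥0 → Ω → ℝ := fun n =>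
    stoppedProcess (fun i ↦ {ω | ⊥ < τ n ω}.indicator (M i)) (τ n) with hY
  have hB0 : ∀ ω, 0 ≤ B := fun ω => (abs_nonneg _).trans (hB 0 zero_le ω)
  have hY0 : ∀ n, ∫ ω, Y n T ω ∂Q = 0 := by
    intro n
    have h := (hM n).setIntegral_eq (zero_le : (0 : ℝ≥0) ≤ T) MeasurableSet.univ
    simp only [Measure.restrict_univ] at h
    change ∫ ω, Y n 0 ω ∂Q = ∫ ω, Y n T ω ∂Q at h
    rw [← h]
    refine integral_eq_zero_of_ae (ae_of_all _ fun ω => ?_)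
    have : (min ((0 : ℝ≥0) : WithTop ℝ≥0) (τ n ω)) = ((0 : ℝ≥0) : WithTop ℝ≥0) :=
      min_eq_left (by exact bot_le)
    simp only [hY, stoppedProcess, this, Pi.zero_apply]
    simp [indicator, h0]
  have hlim : Tendsto (fun n => ∫ ω, Y n T ω ∂Q) atTop (𝓝 (∫ ω, M T ω ∂Q)) := by
    refine tendsto_integral_of_dominated_convergence (fun _ => B)
      (fun n => ((hM n).integrable T).aestronglyMeasurable) (integrable_const _) ?_ ?_
    · refine fun n => ae_of_all _ fun ω => ?_
      have hle : (min (T : WithTop ℝ≥0) (τ n ω)).untopA ≤ T := by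
        apply WithTop.untopA_le
        exact min_le_left _ _
      simp only [hY, stoppedProcess, Real.norm_eq_abs, indicator]
      split_ifs
      · exact hB _ hle ω
      · simpa using hB0 ω
    · filter_upwards [hτ.tendsto_top] with ω hω
      refine tendsto_const_nhds.congr' ?_
      -- Once `τ n ω` exceeds `T`, neither the stopping nor the indicator has any effect at time
      -- `T`.
      filter_upwards [hω.eventually (lt_mem_nhds (WithTop.coe_lt_top T))] with n hn
      simp only [hY, stoppedProcess, min_eq_left hn.le]
      have : ω ∈ {ω | ⊥ < τ n ω} := bot_le.trans_lt hn
      rw [indicator_of_mem this, show (T : WithTop ℝ≥0).untopA = T from rfl]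
  simp only [hY0] at hlim
  exact (tendsto_nhds_unique hlim tendsto_const_nhds)

variable {σ : ℝ → ℝ → ℝ} {x₀ : ℝ} {Q : Measure Ω} {ℱ : Filtration ℝ≥0 mΩ} {X : ℝ≥0 → Ω → ℝ}

lemma IsLocalVolModel.measurable (hX : IsLocalVolModel σ x₀ Q ℱ X) (t : ℝ≥0) :
    Measurable (X t) :=
  ((hX.adapted t).mono (ℱ.le t)).measurable

lemma IsLocalVolModel.integrable_diffusionRate [IsProbabilityMeasure Q]
    (hX : IsLocalVolModel σ x₀ Q ℱ X)
    (hσ : ContinuousOn (fun p : ℝ × ℝ => σ p.1 p.2) (Ici 0 ×ˢ Ioi 0))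
    {ρ : ℝ → ℝ} (hρ : Continuous ρ) {a b : ℝ} (ha : 0 < a) (hρa : ∀ y, y ≤ a → ρ y = 0)
    (hρb : ∀ y, b ≤ y → ρ y = 0) (T : ℝ) :
    Integrable (fun p : ℝ × Ω => diffusionRate σ ρ a p.1 (X p.1.toNNReal p.2))
      ((volume.restrict (Ioc 0 T)).prod Q) := by
  obtain ⟨B, -, hB⟩ := exists_bound_diffusionRate hσ hρ ha hρa hρb T
  have hm : StronglyMeasurable
      (Function.uncurry fun (s : ℝ) (ω : Ω) => diffusionRate σ ρ a s (X s.toNNReal ω)) := by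
    refine stronglyMeasurable_uncurry_of_continuous_of_stronglyMeasurable (fun ω => ?_) fun s => ?_
    · exact (continuous_diffusionRate hσ hρ ha).comp
        (continuous_id.prodMk ((hX.continuous ω).comp continuous_real_toNNReal))
    · refine Measurable.stronglyMeasurable ?_
      exact (continuous_diffusionRate hσ hρ ha).measurable.comp
        (measurable_const.prodMk (hX.measurable _))
  refine Integrable.mono' (integrable_const B) hm.aestronglyMeasurable ?_
  have : ∀ᵐ p : ℝ × Ω ∂((volume.restrict (Ioc 0 T)).prod Q), p.1 ∈ Ioc 0 T :=
    Measure.quasiMeasurePreserving_fst.ae (ae_restrict_mem measurableSet_Ioc)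
  filter_upwards [this] with p hp
  exact hB p.1 ⟨hp.1.le, hp.2⟩ _

lemma IsLocalVolModel.intervalIntegrable_integral_diffusionRate [IsProbabilityMeasure Q]
    (hX : IsLocalVolModel σ x₀ Q ℱ X)
    (hσ : ContinuousOn (fun p : ℝ × ℝ => σ p.1 p.2) (Ici 0 ×ˢ Ioi 0))
    {ρ : ℝ → ℝ} (hρ : Continuous ρ) {a b : ℝ} (ha : 0 < a) (hρa : ∀ y, y ≤ a → ρ y = 0)
    (hρb : ∀ y, b ≤ y → ρ y = 0) {S T : ℝ} (hS : 0 ≤ S) (hT : 0 ≤ T) :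
    IntervalIntegrable (fun s => ∫ ω, diffusionRate σ ρ a s (X s.toNNReal ω) ∂Q) volume S T := by
  have : ∀ T, 0 ≤ T →
      IntervalIntegrable (fun s => ∫ ω, diffusionRate σ ρ a s (X s.toNNReal ω) ∂Q) volume 0 T := by
    intro T hT
    rw [intervalIntegrable_iff_integrableOn_Ioc_of_le hT]
    exact (hX.integrable_diffusionRate hσ hρ ha hρa hρb T).integral_prod_left
  exact (this S hS).symm.trans (this T hT)

/-- Dynkin's formula for the test functions `concaveTest`. -/
lemma IsLocalVolModel.integral_concaveTest [IsProbabilityMeasure Q]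
    (hX : IsLocalVolModel σ x₀ Q ℱ X)
    (hσ : ContinuousOn (fun p : ℝ × ℝ => σ p.1 p.2) (Ici 0 ×ˢ Ioi 0))
    {ρ : ℝ → ℝ} (hρ : Continuous ρ) {a b : ℝ} (ha : 0 < a) (hb0 : 0 ≤ b)
    (hρa : ∀ y, y ≤ a → ρ y = 0) (hρb : ∀ y, b ≤ y → ρ y = 0) (T : ℝ≥0) :
    ∫ ω, concaveTest ρ b (X T ω) ∂Q = concaveTest ρ b x₀ -
      ∫ s in (0 : ℝ)..T, ∫ ω, diffusionRate σ ρ a s (X s.toNNReal ω) ∂Q := by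
  obtain ⟨B, hB0, hB⟩ := exists_bound_diffusionRate hσ hρ ha hρa hρb (T : ℝ)
  obtain ⟨B', hB'⟩ := abs_concaveTest_le hρ hb0 hρb
  have hgen : ∀ (t : ℝ≥0) ω,
      ∫ s in (0 : ℝ)..t, generator σ (concaveTest ρ b) s (X s.toNNReal ω) =
        -∫ s in (0 : ℝ)..t, diffusionRate σ ρ a s (X s.toNNReal ω) := by
    intro t ω
    rw [← intervalIntegral.integral_neg]
    refine intervalIntegral.integral_congr fun s hs => ?_
    rw [uIcc_of_le t.coe_nonneg] at hs
    exact generator_concaveTest σ hρ ha hρa b hs.1 _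
  have hM := hX.localMartingale _ (contDiff_concaveTest hρ b)
  simp only [hgen, sub_neg_eq_add] at hM
  have hx₀ : ∀ ω : Ω, 0 ≤ x₀ := fun ω => hX.initial ω ▸ hX.nonneg 0 ω
  -- The bound consists of `B'` for each of the two values of the test function and `B * T` for the
  -- time integral of the rate.
  have key := integral_eq_zero_of_locally_martingale hM (fun ω => by simp [hX.initial]) T
    (B := B' + B' + B * T) (fun t ht ω => by
      have h1 := hB' _ (hX.nonneg t ω)
      have h2 := hB' _ (hx₀ ω)
      have h3 : |∫ s in (0 : ℝ)..t, diffusionRate σ ρ a s (X s.toNNReal ω)| ≤ B * T := by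
        have h4 : |∫ s in (0 : ℝ)..t, diffusionRate σ ρ a s (X s.toNNReal ω)| ≤ B * |(t : ℝ) - 0| := by
          rw [← Real.norm_eq_abs]
          refine intervalIntegral.norm_integral_le_of_norm_le_const fun s hs => ?_
          rw [uIoc_of_le t.coe_nonneg] at hs
          exact hB s ⟨hs.1.le, hs.2.trans (by exact_mod_cast ht)⟩ _
        refine h4.trans (mul_le_mul_of_nonneg_left ?_ hB0)
        rw [sub_zero, abs_of_nonneg t.coe_nonneg]
        exact_mod_cast ht
      refine (abs_add_le _ _).trans (add_le_add ((abs_sub _ _).trans (add_le_add h1 h2)) h3))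
  have hφm : Integrable (fun ω => concaveTest ρ b (X T ω)) Q :=
    Integrable.mono' (integrable_const B')
      ((contDiff_concaveTest hρ b).continuous.measurable.comp
        (hX.measurable T)).aestronglyMeasurable (ae_of_all _ fun ω => hB' _ (hX.nonneg T ω))
  have hint := hX.integrable_diffusionRate hσ hρ ha hρa hρb T
  have hswap := integral_integral_swap (f := fun (s : ℝ) (ω : Ω) =>
    diffusionRate σ ρ a s (X s.toNNReal ω)) hint
  have hi2 : Integrable (fun ω => ∫ s in Ioc (0 : ℝ) T, diffusionRate σ ρ a s (X s.toNNReal ω)) Q :=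
    hint.integral_prod_right
  have hi1 : Integrable (fun ω => concaveTest ρ b (X T ω) - concaveTest ρ b x₀) Q :=
    hφm.sub (integrable_const _)
  simp only [intervalIntegral.integral_of_le T.coe_nonneg] at key ⊢
  rw [integral_add hi1 hi2,
    integral_sub hφm (integrable_const _)] at key
  simp only [integral_const, probReal_univ, one_smul] at key
  rw [hswap]
  linarith

end Dynkin

/-! ### Truncated means, the supermartingale property and call prices -/

/-- The tent function of height and half-width `δ` centred at `K`. -/
def tent (K δ y : ℝ) : ℝ := max 0 (δ - |y - K|)

lemma continuous_tent (K δ : ℝ) : Continuous (tent K δ) := by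
  unfold tent; fun_prop

lemma tent_nonneg (K δ y : ℝ) : 0 ≤ tent K δ y := le_max_left _ _

lemma tent_eq_zero_of_le {K δ y : ℝ} (h : y ≤ K - δ) : tent K δ y = 0 := by
  refine max_eq_left ?_
  have := neg_abs_le (y - K)
  linarith

lemma tent_eq_zero_of_ge {K δ y : ℝ} (h : K + δ ≤ y) : tent K δ y = 0 := by
  refine max_eq_left ?_
  have := le_abs_self (y - K)
  linarith

lemma integral_tent_pos {K δ : ℝ} (hK : 0 < K) (hδ : 0 < δ) :
    0 < ∫ y in (0 : ℝ)..(K + δ), tent K δ y := by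
  refine intervalIntegral.integral_pos (by linarith) (continuous_tent K δ).continuousOn
    (fun y _ => tent_nonneg K δ y) ⟨K, ⟨hK.le, by linarith⟩, ?_⟩
  simp [tent, hδ]

/-- Tents concentrate at `K`, so if `g K < 0` then a narrow enough tent gives a negative integral.
-/
lemma nonneg_of_integral_tent_mul_nonneg {g : ℝ → ℝ} (hg : Continuous g) {K : ℝ} (hK : 0 < K)
    (h : ∀ δ, 0 < δ → δ < K → 0 ≤ ∫ y in (0 : ℝ)..(K + δ), tent K δ y * g y) : 0 ≤ g K := by
  by_contra! hneg
  have hev : ∀ᶠ y in 𝓝 K, g y < g K / 2 :=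
    hg.continuousAt.eventually (gt_mem_nhds (by linarith))
  obtain ⟨r, hr, hball⟩ := Metric.eventually_nhds_iff.1 hev
  set δ := min r K / 2 with hδ
  have hδ0 : 0 < δ := by have := lt_min hr hK; positivity
  have hδr : δ < r := by have := min_le_left r K; have := lt_min hr hK; linarith
  have hδK : δ < K := by have := min_le_right r K; have := lt_min hr hK; linarith
  have h1 : ∫ y in (0 : ℝ)..(K + δ), tent K δ y * g y ≤
      ∫ y in (0 : ℝ)..(K + δ), tent K δ y * (g K / 2) := by
    refine intervalIntegral.integral_mono_on (by linarith)
      (((continuous_tent K δ).mul hg).intervalIntegrable _ _)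
      (((continuous_tent K δ).mul continuous_const).intervalIntegrable _ _) fun y _ => ?_
    rcases lt_or_ge |y - K| δ with hy | hy
    · exact mul_le_mul_of_nonneg_left (hball (by rw [Real.dist_eq]; linarith)).le
        (tent_nonneg _ _ _)
    · simp [tent, max_eq_left (sub_nonpos.2 hy)]
  rw [intervalIntegral.integral_mul_const] at h1
  have := mul_neg_of_pos_of_neg (integral_tent_pos hK hδ0) (by linarith : g K / 2 < 0)
  linarith [h δ hδ0 hδK]

/-- Fatou's lemma. -/
lemma integrable_of_tendsto_of_liminf_lintegral {Ω : Type*} {mΩ : MeasurableSpace Ω}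
    {Q : Measure Ω} {G : ℕ → Ω → ℝ} {f : Ω → ℝ}
    (hGf : ∀ᵐ x ∂Q, Tendsto (fun n => G n x) atTop (𝓝 (f x)))
    (hG : ∀ n, AEStronglyMeasurable (G n) Q)
    (hG' : liminf (fun n => ∫⁻ x, ‖G n x‖ₑ ∂Q) atTop ≠ ⊤) : Integrable f Q := by
  refine ⟨aestronglyMeasurable_of_tendsto_ae _ hG hGf, lt_of_le_of_lt ?_ hG'.lt_top⟩
  refine le_trans (le_of_eq ?_) (lintegral_liminf_le' fun n => (hG n).aemeasurable.enorm)
  exact lintegral_congr_ae (by filter_upwards [hGf] with x hx using hx.enorm.liminf_eq.symm)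

section Model

variable {Ω : Type*} {mΩ : MeasurableSpace Ω} {σ : ℝ → ℝ → ℝ} {x₀ : ℝ} {Q : Measure Ω}
  {ℱ : Filtration ℝ≥0 mΩ} {X : ℝ≥0 → Ω → ℝ}

/-- The truncated mean `E[X_T ∧ K]`. -/
def truncMean (Q : Measure Ω) (X : ℝ≥0 → Ω → ℝ) (T : ℝ≥0) (K : ℝ) : ℝ := ∫ ω, min (X T ω) K ∂Q

lemma abs_min_le_abs {x y : ℝ} (hx : 0 ≤ x) : |min x y| ≤ |y| := by
  rcases le_total x y with h | h
  · rw [min_eq_left h, abs_of_nonneg hx]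
    exact h.trans (le_abs_self y)
  · rw [min_eq_right h]

lemma IsLocalVolModel.integrable_min [IsProbabilityMeasure Q] (hX : IsLocalVolModel σ x₀ Q ℱ X)
    (T : ℝ≥0) (K : ℝ) : Integrable (fun ω => min (X T ω) K) Q :=
  Integrable.mono' (integrable_const |K|)
    ((hX.measurable T).min measurable_const).aestronglyMeasurable
    (ae_of_all _ fun ω => abs_min_le_abs (hX.nonneg T ω))

lemma IsLocalVolModel.abs_truncMean_sub_le [IsProbabilityMeasure Q]
    (hX : IsLocalVolModel σ x₀ Q ℱ X) (T : ℝ≥0) (K L : ℝ) :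
    |truncMean Q X T K - truncMean Q X T L| ≤ |K - L| := by
  rw [truncMean, truncMean, ← integral_sub (hX.integrable_min T K) (hX.integrable_min T L)]
  have := norm_integral_le_of_norm_le_const (μ := Q) (C := |K - L|)
    (f := fun ω => min (X T ω) K - min (X T ω) L) (ae_of_all _ fun ω => by
      have := abs_min_sub_min_le_max (X T ω) K (X T ω) L
      rwa [sub_self, abs_zero, max_eq_right (abs_nonneg _)] at this)
  simpa using this

lemma IsLocalVolModel.continuous_truncMean [IsProbabilityMeasure Q]
    (hX : IsLocalVolModel σ x₀ Q ℱ X) (T : ℝ≥0) : Continuous (truncMean Q X T) := by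
  refine (LipschitzWith.of_dist_le_mul (K := 1) fun K L => ?_).continuous
  simpa [Real.dist_eq] using hX.abs_truncMean_sub_le T K L

lemma IsLocalVolModel.integral_mul_truncMean [IsProbabilityMeasure Q]
    (hX : IsLocalVolModel σ x₀ Q ℱ X) {ρ : ℝ → ℝ} (hρ : Continuous ρ) {b : ℝ} (hb0 : 0 ≤ b)
    (hρb : ∀ y, b ≤ y → ρ y = 0) (T : ℝ≥0) :
    ∫ y in (0 : ℝ)..b, ρ y * truncMean Q X T y = ∫ ω, concaveTest ρ b (X T ω) ∂Q := by
  obtain ⟨B, hB⟩ := isCompact_Icc.exists_bound_of_continuousOn (s := Icc 0 b) hρ.continuousOn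
  have hm : StronglyMeasurable
      (Function.uncurry fun (y : ℝ) (ω : Ω) => ρ y * min (X T ω) y) := by
    refine stronglyMeasurable_uncurry_of_continuous_of_stronglyMeasurable (fun ω => ?_) fun y => ?_
    · exact hρ.mul (continuous_const.min continuous_id)
    · exact (((hX.measurable T).min measurable_const).const_mul _).stronglyMeasurable
  have hint : Integrable (Function.uncurry fun (y : ℝ) (ω : Ω) => ρ y * min (X T ω) y)
      ((volume.restrict (Ioc 0 b)).prod Q) := by
    refine Integrable.mono' (integrable_const (B * b)) hm.aestronglyMeasurable ?_
    have : ∀ᵐ p : ℝ × Ω ∂((volume.restrict (Ioc 0 b)).prod Q), p.1 ∈ Ioc 0 b :=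
      Measure.quasiMeasurePreserving_fst.ae (ae_restrict_mem measurableSet_Ioc)
    filter_upwards [this] with p hp
    have h1 := hB p.1 ⟨hp.1.le, hp.2⟩
    simp only [Function.uncurry, norm_mul]
    refine mul_le_mul h1 ?_ (norm_nonneg _) ((norm_nonneg _).trans h1)
    exact (abs_min_le_abs (hX.nonneg T _)).trans (by rw [abs_of_pos hp.1]; exact hp.2)
  have hswap := integral_integral_swap hint
  simp only [integral_const_mul] at hswap
  rw [intervalIntegral.integral_of_le hb0]
  refine hswap.trans (integral_congr_ae (ae_of_all _ fun ω => ?_))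
  simp only [concaveTest_eq hρ hρb (hX.nonneg T ω), intervalIntegral.integral_of_le hb0]

/-- The weak form of the forward equation. It gives monotonicity in time when `ρ ≥ 0`, and Dupire's
equation when `ρ` is a narrow tent. -/
lemma IsLocalVolModel.integral_mul_truncMean_sub [IsProbabilityMeasure Q]
    (hX : IsLocalVolModel σ x₀ Q ℱ X)
    (hσ : ContinuousOn (fun p : ℝ × ℝ => σ p.1 p.2) (Ici 0 ×ˢ Ioi 0))
    {ρ : ℝ → ℝ} (hρ : Continuous ρ) {a b : ℝ} (ha : 0 < a) (hb0 : 0 ≤ b)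
    (hρa : ∀ y, y ≤ a → ρ y = 0) (hρb : ∀ y, b ≤ y → ρ y = 0) (S T : ℝ≥0) :
    ∫ y in (0 : ℝ)..b, ρ y * (truncMean Q X S y - truncMean Q X T y) =
      ∫ s in (S : ℝ)..T, ∫ ω, diffusionRate σ ρ a s (X s.toNNReal ω) ∂Q := by
  have hi := fun {S T : ℝ} (hS : 0 ≤ S) (hT : 0 ≤ T) =>
    hX.intervalIntegrable_integral_diffusionRate hσ hρ ha hρa hρb hS hT
  have hc : ∀ T, IntervalIntegrable (fun y => ρ y * truncMean Q X T y) volume 0 b :=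
    fun T => (hρ.mul (hX.continuous_truncMean T)).intervalIntegrable 0 b
  simp only [mul_sub]
  rw [intervalIntegral.integral_sub (hc S) (hc T), hX.integral_mul_truncMean hρ hb0 hρb,
    hX.integral_mul_truncMean hρ hb0 hρb, hX.integral_concaveTest hσ hρ ha hb0 hρa hρb,
    hX.integral_concaveTest hσ hρ ha hb0 hρa hρb,
    ← intervalIntegral.integral_interval_sub_left (hi le_rfl T.coe_nonneg)
      (hi le_rfl S.coe_nonneg)]
  ring

/-- `min · K` is concave but not `C²`. The forward equation shows that the inequality holds after
averaging against tents, and continuity in the strike recovers it at `K`. -/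
lemma IsLocalVolModel.truncMean_antitone [IsProbabilityMeasure Q]
    (hX : IsLocalVolModel σ x₀ Q ℱ X)
    (hσ : ContinuousOn (fun p : ℝ × ℝ => σ p.1 p.2) (Ici 0 ×ˢ Ioi 0)) {S T : ℝ≥0} (hST : S ≤ T)
    {K : ℝ} (hK : 0 < K) : truncMean Q X T K ≤ truncMean Q X S K := by
  rw [← sub_nonneg]
  refine nonneg_of_integral_tent_mul_nonneg
    (g := fun y => truncMean Q X S y - truncMean Q X T y)
    ((hX.continuous_truncMean S).sub (hX.continuous_truncMean T)) hK fun δ hδ hδK => ?_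
  rw [hX.integral_mul_truncMean_sub hσ (continuous_tent K δ) (sub_pos.2 hδK) (by linarith)
    (fun y => tent_eq_zero_of_le) (fun y => tent_eq_zero_of_ge)]
  refine intervalIntegral.integral_nonneg (by exact_mod_cast hST) fun s _ =>
    integral_nonneg fun ω => ?_
  have := tent_nonneg K δ (X s.toNNReal ω)
  simp only [diffusionRate, Pi.zero_apply]
  positivity

lemma IsLocalVolModel.truncMean_le [IsProbabilityMeasure Q]
    (hX : IsLocalVolModel σ x₀ Q ℱ X)
    (hσ : ContinuousOn (fun p : ℝ × ℝ => σ p.1 p.2) (Ici 0 ×ˢ Ioi 0)) (T : ℝ≥0)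
    {K : ℝ} (hK : 0 < K) : truncMean Q X T K ≤ x₀ := by
  refine (hX.truncMean_antitone hσ (zero_le : 0 ≤ T) hK).trans ?_
  simp [truncMean, hX.initial]

/-- The truncated means are bounded by `x₀`. Integrability has to be known before `callPrice` can be
split, since the Bochner integral of a non-integrable function is `0` by convention. -/
lemma IsLocalVolModel.integrable [IsProbabilityMeasure Q]
    (hX : IsLocalVolModel σ x₀ Q ℱ X)
    (hσ : ContinuousOn (fun p : ℝ × ℝ => σ p.1 p.2) (Ici 0 ×ˢ Ioi 0)) (T : ℝ≥0) :
    Integrable (X T) Q := by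
  refine integrable_of_tendsto_of_liminf_lintegral
    (G := fun (n : ℕ) ω => min (X T ω) ((n : ℝ) + 1))
    (ae_of_all _ fun ω => ?_) (fun n => (hX.integrable_min T _).aestronglyMeasurable) ?_
  · refine tendsto_const_nhds.congr' ?_
    filter_upwards [eventually_ge_atTop ⌈X T ω⌉₊] with n hn
    exact (min_eq_left ((Nat.ceil_le.1 hn).trans (by linarith))).symm
  · refine ((liminf_le_of_le (a := ENNReal.ofReal x₀) ?_ ?_).trans_lt ENNReal.ofReal_lt_top).ne
    · isBoundedDefault
    · intro b hb
      obtain ⟨n, hn⟩ := hb.exists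
      refine hn.trans ?_
      have hn0 : (0 : ℝ) < n + 1 := by positivity
      rw [← ofReal_integral_norm_eq_lintegral_enorm (hX.integrable_min T _)]
      refine ENNReal.ofReal_le_ofReal ?_
      refine le_trans (le_of_eq ?_) (hX.truncMean_le hσ T hn0)
      refine integral_congr_ae (ae_of_all _ fun ω => ?_)
      exact abs_of_nonneg (le_min (hX.nonneg T ω) hn0.le)

lemma IsLocalVolModel.tendsto_truncMean [IsProbabilityMeasure Q]
    (hX : IsLocalVolModel σ x₀ Q ℱ X)
    (hσ : ContinuousOn (fun p : ℝ × ℝ => σ p.1 p.2) (Ici 0 ×ˢ Ioi 0)) (T : ℝ≥0) :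
    Tendsto (fun n : ℕ => truncMean Q X T ((n : ℝ) + 1)) atTop (𝓝 (∫ ω, X T ω ∂Q)) := by
  refine tendsto_integral_of_dominated_convergence (X T)
    (fun n => (hX.integrable_min T _).aestronglyMeasurable) (hX.integrable hσ T)
    (fun n => ae_of_all _ fun ω => ?_) (ae_of_all _ fun ω => ?_)
  · have hn0 : (0 : ℝ) ≤ n + 1 := by positivity
    rw [Real.norm_eq_abs, abs_of_nonneg (le_min (hX.nonneg T ω) hn0)]
    exact min_le_left _ _
  · refine tendsto_const_nhds.congr' ?_
    filter_upwards [eventually_ge_atTop ⌈X T ω⌉₊] with n hn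
    exact (min_eq_left ((Nat.ceil_le.1 hn).trans (by linarith))).symm

lemma IsLocalVolModel.integral_antitone [IsProbabilityMeasure Q]
    (hX : IsLocalVolModel σ x₀ Q ℱ X)
    (hσ : ContinuousOn (fun p : ℝ × ℝ => σ p.1 p.2) (Ici 0 ×ˢ Ioi 0)) {S T : ℝ≥0}
    (hST : S ≤ T) : ∫ ω, X T ω ∂Q ≤ ∫ ω, X S ω ∂Q :=
  le_of_tendsto_of_tendsto' (hX.tendsto_truncMean hσ T) (hX.tendsto_truncMean hσ S)
    fun n => hX.truncMean_antitone hσ hST (by positivity)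

lemma IsLocalVolModel.truncMean_nonneg (hX : IsLocalVolModel σ x₀ Q ℱ X) (T : ℝ≥0) {K : ℝ}
    (hK : 0 ≤ K) : 0 ≤ truncMean Q X T K :=
  integral_nonneg fun ω => le_min (hX.nonneg T ω) hK

lemma IsLocalVolModel.truncMean_zero (hX : IsLocalVolModel σ x₀ Q ℱ X) (T : ℝ≥0) :
    truncMean Q X T 0 = 0 := by
  simp [truncMean, min_eq_right (hX.nonneg T _)]

lemma IsLocalVolModel.callPrice_eq [IsProbabilityMeasure Q]
    (hX : IsLocalVolModel σ x₀ Q ℱ X)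
    (hσ : ContinuousOn (fun p : ℝ × ℝ => σ p.1 p.2) (Ici 0 ×ˢ Ioi 0)) (α : ℝ) (T : ℝ≥0) (K : ℝ) :
    callPrice α x₀ Q X T K =
      (1 - α) * (∫ ω, X T ω ∂Q) + α * x₀ - truncMean Q X T K := by
  have : ∫ ω, max (X T ω - K) 0 ∂Q = (∫ ω, X T ω ∂Q) - truncMean Q X T K := by
    rw [truncMean, ← integral_sub (hX.integrable hσ T) (hX.integrable_min T K)]
    refine integral_congr_ae (ae_of_all _ fun ω => ?_)
    simp only
    rw [sub_eq_add_neg _ (min _ _), ← max_neg_neg, ← max_add_add_left]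
    simp [sub_eq_add_neg, max_comm]
  rw [callPrice, this]
  ring

end Model

/-! ### The bubble criterion for `α < 1` -/

lemma onPos_of_pos (g : Ioi (0 : ℝ) → ℝ) {y : ℝ} (hy : 0 < y) : onPos g y = g ⟨y, hy⟩ := by
  simp [onPos, hy]

/-- The limit `E T` of the prices at strike zero is nonincreasing in `T`, so one integer time
decides. As all prices at that time lie below their limit, `E n ≤ r` can be tested along `1 / (k +
1)`. -/
lemma bubbleAtZero_iff {α x₀ : ℝ} (hα : α < 1) {f : PriceSurface} (hf : f ∈ callSurfaces α x₀) :
    BubbleAtZero x₀ f ↔ ∃ (n : ℕ) (r : ℚ), (r : ℝ) < x₀ ∧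
      ∀ k : ℕ, f.val (n, ⟨1 / ((k : ℝ) + 1), mem_Ioi.2 Nat.one_div_pos_of_nat⟩) ≤ r := by
  obtain ⟨⟨σ, hσ, -, Ω, mΩ, Q, ℱ, X, hQ, hX, hf⟩, -⟩ := hf
  set E : ℝ≥0 → ℝ := fun T => (1 - α) * (∫ ω, X T ω ∂Q) + α * x₀ with hE
  have hval : ∀ (T : ℝ≥0) (K : Ioi (0 : ℝ)), f.val (T, K) = E T - truncMean Q X T K := by
    intro T K
    rw [hf, hX.callPrice_eq hσ.continuousOn]
  have hlim : ∀ T : ℝ≥0, Tendsto (onPos fun x => f.val (T, x)) (𝓝[>] 0) (𝓝 (E T)) := by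
    intro T
    have h1 : Tendsto (fun y => E T - truncMean Q X T y) (𝓝[>] 0) (𝓝 (E T)) := by
      have : Tendsto (fun y => E T - truncMean Q X T y) (𝓝 0) (𝓝 (E T - truncMean Q X T 0)) :=
        (continuous_const.sub (hX.continuous_truncMean T)).tendsto 0
      rw [hX.truncMean_zero, sub_zero] at this
      exact this.mono_left nhdsWithin_le_nhds
    refine h1.congr' ?_
    filter_upwards [self_mem_nhdsWithin] with y hy
    rw [onPos_of_pos _ hy, hval]
  constructor
  · rintro ⟨t, ht⟩
    obtain ⟨n, hn⟩ := exists_nat_ge t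
    obtain ⟨l, hl, hlx⟩ := ht n hn
    rw [tendsto_nhds_unique hl (hlim n)] at hlx
    obtain ⟨r, hr1, hr2⟩ := exists_rat_btwn hlx
    refine ⟨n, r, hr2, fun k => ?_⟩
    rw [hval]
    have hk : (0 : ℝ) < 1 / ((k : ℝ) + 1) := Nat.one_div_pos_of_nat
    linarith [hX.truncMean_nonneg (n : ℝ≥0) hk.le]
  · rintro ⟨n, r, hr, h⟩
    refine ⟨n, fun T hT => ⟨E T, hlim T, ?_⟩⟩
    have h1 : E n ≤ r := by
      have h2 : Tendsto (fun k : ℕ => onPos (fun x => f.val (n, x)) (1 / ((k : ℝ) + 1))) atTop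
          (𝓝 (E n)) := by
        refine (hlim n).comp (tendsto_nhdsWithin_iff.2
          ⟨tendsto_one_div_add_atTop_nhds_zero_nat, Eventually.of_forall fun k => ?_⟩)
        exact mem_Ioi.2 Nat.one_div_pos_of_nat
      refine le_of_tendsto' h2 fun k => ?_
      have hk : (0 : ℝ) < 1 / ((k : ℝ) + 1) := Nat.one_div_pos_of_nat
      rw [onPos_of_pos _ hk]
      exact h k
    have h3 : E T ≤ E n := by
      have := mul_le_mul_of_nonneg_left (hX.integral_antitone hσ.continuousOn hT)
        (sub_nonneg.2 hα.le)
      simp only [hE]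
      linarith
    linarith

lemma measurable_onPos {g : Ioi (0 : ℝ) → ℝ} (hg : Measurable g) : Measurable (onPos g) := by
  unfold onPos
  exact Measurable.dite (s := Ioi (0 : ℝ)) hg measurable_const measurableSet_Ioi

lemma continuousOn_onPos {g : Ioi (0 : ℝ) → ℝ} (hg : Continuous g) :
    ContinuousOn (onPos g) (Ioi 0) := by
  rw [continuousOn_iff_continuous_domRestrict]
  refine hg.congr fun x => ?_
  rw [domRestrict_apply, onPos_of_pos _ x.2]

/-! ### Marginal densities and Dupire's equation for `α = 1` -/

section Density

variable {Ω : Type*} {mΩ : MeasurableSpace Ω} {σ : ℝ → ℝ → ℝ} {x₀ : ℝ} {Q : Measure Ω}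
  {ℱ : Filtration ℝ≥0 mΩ} {X : ℝ≥0 → Ω → ℝ}

/-- The truncated mean is concave in the strike with supergradient `Q(X_T > K)` at `K`. Where it is
differentiable, the supergradient is the derivative. -/
lemma IsLocalVolModel.measureReal_gt [IsProbabilityMeasure Q] (hX : IsLocalVolModel σ x₀ Q ℱ X)
    {T : ℝ≥0} {K d : ℝ} (hd : HasDerivAt (truncMean Q X T) d K) :
    Q.real {ω | K < X T ω} = d := by
  set p := Q.real {ω | K < X T ω} with hp
  have hs : MeasurableSet {ω | K < X T ω} := measurableSet_lt measurable_const (hX.measurable T)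
  have hle : ∀ L, truncMean Q X T L ≤ truncMean Q X T K + (L - K) * p := by
    intro L
    have hi : Integrable ({ω | K < X T ω}.indicator fun _ => L - K) Q :=
      (integrable_const _).indicator hs
    have h1 : (L - K) * p = ∫ ω, {ω | K < X T ω}.indicator (fun _ => L - K) ω ∂Q := by
      rw [integral_indicator_const _ hs, smul_eq_mul, mul_comm]
    rw [h1, truncMean, truncMean, ← integral_add (hX.integrable_min T K) hi]
    refine integral_mono (hX.integrable_min T L) ((hX.integrable_min T K).add hi) fun ω => ?_
    by_cases h : K < X T ω
    · have : ω ∈ {ω | K < X T ω} := h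
      simp [indicator_of_mem this, min_eq_right h.le]
    · have : ω ∉ {ω | K < X T ω} := h
      simp [indicator_of_notMem this, min_eq_left (not_lt.1 h)]
  have hmax : IsLocalMax (fun L => truncMean Q X T L - (L - K) * p) K :=
    Eventually.of_forall fun L => by simpa using hle L
  have h0 := hmax.hasDerivAt_eq_zero (hd.sub (((hasDerivAt_id K).sub_const K).mul_const p))
  linarith

/-- The expectation of a function of `X_T` supported in `(a, b]` when `X_T` has density `p`. -/
lemma IsLocalVolModel.integral_comp_eq [IsProbabilityMeasure Q]
    (hX : IsLocalVolModel σ x₀ Q ℱ X) {T : ℝ≥0} {D p : ℝ → ℝ}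
    (hD : ∀ K, 0 < K → HasDerivAt (truncMean Q X T) (-D K) K)
    (hp : ∀ K, 0 < K → HasDerivAt D (p K) K) (hpc : ContinuousOn p (Ioi 0)) (hpm : Measurable p)
    (hp0 : ∀ K, 0 < K → 0 ≤ p K) {h : ℝ → ℝ} (hh : Continuous h) {a b : ℝ} (ha : 0 < a)
    (hab : a ≤ b) (hha : ∀ y, y ≤ a → h y = 0) (hhb : ∀ y, b ≤ y → h y = 0) :
    ∫ ω, h (X T ω) ∂Q = ∫ y in a..b, h y * p y := by
  have hXm := hX.measurable T
  have hprob : IsProbabilityMeasure (Q.map (X T)) :=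
    Measure.isProbabilityMeasure_map hXm.aemeasurable
  have hIoc : ∀ lo hi, 0 < lo → lo ≤ hi → (Q.map (X T)) (Ioc lo hi) =
      ∫⁻ y in Ioc lo hi, ENNReal.ofReal (p y) := by
    intro lo hi hlo hle
    have hcont : ContinuousOn p (Icc lo hi) := hpc.mono fun y hy => hlo.trans_le hy.1
    have hint : IntegrableOn p (Ioc lo hi) :=
      (hcont.integrableOn_Icc).mono_set Ioc_subset_Icc_self
    rw [← ofReal_integral_eq_lintegral_ofReal hint
      ((ae_restrict_mem measurableSet_Ioc).mono fun y hy => hp0 y (hlo.trans hy.1)),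
      ← intervalIntegral.integral_of_le hle,
      intervalIntegral.integral_eq_sub_of_hasDerivAt
        (fun y hy => hp y (by rw [uIcc_of_le hle] at hy; exact hlo.trans_le hy.1))
        (by rw [intervalIntegrable_iff_integrableOn_Ioc_of_le hle]; exact hint),
      Measure.map_apply hXm measurableSet_Ioc]
    have h1 : X T ⁻¹' Ioc lo hi = {ω | lo < X T ω} \ {ω | hi < X T ω} := by
      ext ω; simp
    have h2 := measureReal_sdiff (μ := Q) (s₁ := {ω | lo < X T ω}) (s₂ := {ω | hi < X T ω})
      (fun ω hω => lt_of_le_of_lt hle hω) (measurableSet_lt measurable_const hXm)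
    rw [hX.measureReal_gt (hD lo hlo), hX.measureReal_gt (hD hi (hlo.trans_le hle))] at h2
    rw [h1, ← ENNReal.ofReal_toReal (measure_ne_top Q _), ← measureReal_def, h2]
    congr 1
    ring
  -- Only strikes in `(a, b]` with `a > 0` are compared, so a possible atom of the law at `0` does
  -- not interfere.
  have hmeas : (Q.map (X T)).restrict (Ioc a b) =
      (volume.restrict (Ioc a b)).withDensity fun y => ENNReal.ofReal (p y) := by
    refine Measure.ext_of_Ioc _ _ fun c d _ => ?_
    rw [Measure.restrict_apply measurableSet_Ioc, withDensity_apply _ measurableSet_Ioc,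
      Measure.restrict_restrict measurableSet_Ioc, Ioc_inter_Ioc]
    rcases le_total (c ⊔ a) (d ⊓ b) with hle | hle
    · exact hIoc _ _ (ha.trans_le le_sup_right) hle
    · simp [Ioc_eq_empty_of_le hle]
  rw [← integral_map hXm.aemeasurable hh.aestronglyMeasurable,
    ← setIntegral_eq_integral_of_forall_compl_eq_zero (s := Ioc a b) (fun y hy => ?_), hmeas,
    integral_withDensity_eq_integral_toReal_smul (by fun_prop) (by simp),
    intervalIntegral.integral_of_le hab]
  · refine setIntegral_congr_fun measurableSet_Ioc fun y hy => ?_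
    simp [ENNReal.toReal_ofReal (hp0 y (ha.trans hy.1)), mul_comm]
  · rw [mem_Ioc, not_and_or, not_lt, not_le] at hy
    rcases hy with hy | hy
    · exact hha y hy
    · exact hhb y hy.le

end Density

/-- One half of Dupire's equation, tested on a rectangle. -/
lemma dupire_aux {x₀ : ℝ} {f : PriceSurface} {σ : ℝ → ℝ → ℝ} (hσ : IsAdmissibleVol σ)
    (hf : IsCallSurface 1 x₀ σ f) (hdxx : ∀ T K : Ioi (0 : ℝ), 0 < f.dxx (T, K))
    {ε u v S T x δ : ℝ} (hS : 0 < S) (hST : S < T) (hδ : 0 < δ) (hδx : δ < x)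
    (hv : ∀ s y : Ioi (0 : ℝ), (s : ℝ) ∈ Icc S T → (y : ℝ) ∈ Icc (x - δ) (x + δ) →
      ε * f.dt (s, y) ≤ v)
    (hu : ∀ s y : Ioi (0 : ℝ), (s : ℝ) ∈ Icc S T → (y : ℝ) ∈ Icc (x - δ) (x + δ) →
      u ≤ ε * (σ s y ^ 2 / 2 * f.dxx (s, y))) : u ≤ v := by
  obtain ⟨Ω, mΩ, Q, ℱ, X, hQ, hX, hf⟩ := hf
  have hx : 0 < x := hδ.trans hδx
  have ha : 0 < x - δ := sub_pos.2 hδx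
  have hab : x - δ ≤ x + δ := by linarith
  have hb0 : 0 ≤ x + δ := by linarith
  have hT : 0 < T := hS.trans hST
  have htc := continuous_tent x δ
  have hta := fun y => tent_eq_zero_of_le (K := x) (δ := δ) (y := y)
  have htb := fun y => tent_eq_zero_of_ge (K := x) (δ := δ) (y := y)
  have hval : ∀ (t : ℝ≥0) (K : Ioi (0 : ℝ)), f.val (t, K) = x₀ - truncMean Q X t K := by
    intro t K
    rw [hf, hX.callPrice_eq hσ.continuousOn]
    ring
  have hpos := integral_tent_pos hx hδ
  have htent : ∫ y in (0 : ℝ)..(x + δ), tent x δ y = ∫ y in (x - δ)..(x + δ), tent x δ y := by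
    rw [← intervalIntegral.integral_add_adjacent_intervals (htc.intervalIntegrable 0 (x - δ))
      (htc.intervalIntegrable _ _), intervalIntegral.integral_congr (g := fun _ => (0 : ℝ))
      (fun y hy => by rw [uIcc_of_le ha.le] at hy; exact hta y hy.2)]
    simp
  have key := hX.integral_mul_truncMean_sub hσ.continuousOn htc ha hb0 hta htb
    S.toNNReal T.toNNReal
  rw [Real.coe_toNNReal _ hS.le, Real.coe_toNNReal _ hT.le] at key
  have hL : ε * (∫ y in (0 : ℝ)..(x + δ), tent x δ y *
      (truncMean Q X S.toNNReal y - truncMean Q X T.toNNReal y)) ≤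
      (v * (T - S)) * ∫ y in (0 : ℝ)..(x + δ), tent x δ y := by
    rw [← intervalIntegral.integral_const_mul, ← intervalIntegral.integral_const_mul]
    refine intervalIntegral.integral_mono_on hb0 ?_ ?_ fun y hy => ?_
    · exact (continuous_const.mul (htc.mul ((hX.continuous_truncMean _).sub
        (hX.continuous_truncMean _)))).intervalIntegrable _ _
    · exact (continuous_const.mul htc).intervalIntegrable _ _
    · rcases le_or_gt y (x - δ) with hya | hya
      · simp [hta y hya]
      have hy0 : 0 < y := ha.trans hya
      have hd : ∀ s, 0 < s → HasDerivAt (fun s : ℝ => ε * f.val (s.toNNReal, ⟨y, hy0⟩))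
          (ε * onPos (fun s => f.dt (s, ⟨y, hy0⟩)) s) s := by
        intro s hs
        have := (f.hasDerivAt_t ⟨s, hs⟩ ⟨y, hy0⟩).const_mul ε
        rwa [onPos_of_pos _ hs]
      -- The mean value theorem at each strike separately avoids differentiating under the integral;
      -- the bound `hv` is uniform, so the dependence of `s` on `y` is harmless.
      obtain ⟨s, hs, hs'⟩ := exists_hasDerivAt_eq_slope
        (fun s : ℝ => ε * f.val (s.toNNReal, ⟨y, hy0⟩))
        (fun s => ε * onPos (fun s => f.dt (s, ⟨y, hy0⟩)) s) hST
        (fun s hs => (hd s (hS.trans_le hs.1)).continuousAt.continuousWithinAt)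
        (fun s hs => hd s (hS.trans hs.1))
      have hs0 : 0 < s := hS.trans hs.1
      rw [onPos_of_pos _ hs0, eq_div_iff (sub_pos.2 hST).ne', hval, hval] at hs'
      have h1 := mul_le_mul_of_nonneg_right
        (hv ⟨s, hs0⟩ ⟨y, hy0⟩ ⟨hs.1.le, hs.2.le⟩ ⟨hya.le, hy.2⟩) (sub_pos.2 hST).le
      rw [hs'] at h1
      have h2 := mul_le_mul_of_nonneg_left h1 (tent_nonneg x δ y)
      calc _ = tent x δ y * (ε * (x₀ - truncMean Q X T.toNNReal y) -
            ε * (x₀ - truncMean Q X S.toNNReal y)) := by ring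
        _ ≤ _ := h2
        _ = _ := by ring
  have hR : (u * (T - S)) * ∫ y in (0 : ℝ)..(x + δ), tent x δ y ≤
      ε * ∫ s in S..T, ∫ ω, diffusionRate σ (tent x δ) (x - δ) s (X s.toNNReal ω) ∂Q := by
    have hconst : (u * (T - S)) * ∫ y in (0 : ℝ)..(x + δ), tent x δ y =
        ∫ _ in S..T, u * ∫ y in (0 : ℝ)..(x + δ), tent x δ y := by
      simp; ring
    rw [hconst, ← intervalIntegral.integral_const_mul ε]
    refine intervalIntegral.integral_mono_on hST.le (by simp)
      ((hX.intervalIntegrable_integral_diffusionRate hσ.continuousOn htc ha hta htb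
        hS.le hT.le).const_mul ε) fun s hs => ?_
    have hs0 : 0 < s := hS.trans_le hs.1
    set p := onPos fun y => f.dxx (⟨s, hs0⟩, y) with hp
    have hpcont : Continuous fun y => f.dxx (⟨s, hs0⟩, y) := by fun_prop
    have hpc : ContinuousOn p (Ioi 0) := continuousOn_onPos hpcont
    have hrate : Continuous (diffusionRate σ (tent x δ) (x - δ) s) :=
      (continuous_diffusionRate hσ.continuousOn htc ha).comp (continuous_const.prodMk continuous_id)
    have hE := hX.integral_comp_eq (T := s.toNNReal) (D := onPos fun y => f.dx (⟨s, hs0⟩, y))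
      (p := p) (fun K hK => ?_) (fun K hK => ?_) hpc (measurable_onPos hpcont.measurable)
      (fun K hK => ?_) hrate ha hab (fun y hy => by simp [diffusionRate, hta y hy])
      (fun y hy => by simp [diffusionRate, htb y hy])
    · rw [hE, htent, ← intervalIntegral.integral_const_mul, ← intervalIntegral.integral_const_mul]
      refine intervalIntegral.integral_mono_on hab
        ((continuous_const.mul htc).intervalIntegrable _ _) ?_ fun y hy => ?_
      · refine ContinuousOn.intervalIntegrable ?_
        rw [uIcc_of_le hab]
        exact continuousOn_const.mul (hrate.continuousOn.mul
          (hpc.mono fun y hy => ha.trans_le hy.1))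
      · have hy0 : 0 < y := ha.trans_le hy.1
        have h2 := mul_le_mul_of_nonneg_right (hu ⟨s, hs0⟩ ⟨y, hy0⟩ hs hy) (tent_nonneg x δ y)
        refine h2.trans (le_of_eq ?_)
        simp only [diffusionRate, max_eq_left hs0.le, max_eq_left hy.1, hp, onPos_of_pos _ hy0]
        ring
    · have h1 := (f.hasDerivAt_x ⟨s, hs0⟩ ⟨K, hK⟩).const_sub x₀
      rw [onPos_of_pos _ hK]
      refine h1.congr_of_eventuallyEq ?_
      filter_upwards [lt_mem_nhds hK] with y hy
      rw [onPos_of_pos _ hy, hval]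
      simp
    · rw [hp, onPos_of_pos _ hK]
      exact f.hasDerivAt_xx ⟨s, hs0⟩ ⟨K, hK⟩
    · rw [hp, onPos_of_pos _ hK]
      exact (hdxx _ _).le
  rw [key] at hL
  have h3 := le_of_mul_le_mul_right (hR.trans hL) hpos
  exact le_of_mul_le_mul_right h3 (sub_pos.2 hST)

/-- If the two sides differed at a point, constants `u > v` would separate them, by continuity, on a
small rectangle, against `dupire_aux`. The signs `ε = 1` and `ε = -1` give the two inequalities. -/
lemma dupire {x₀ : ℝ} {f : PriceSurface} {σ : ℝ → ℝ → ℝ} (hσ : IsAdmissibleVol σ)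
    (hf : IsCallSurface 1 x₀ σ f) (hdxx : ∀ T K : Ioi (0 : ℝ), 0 < f.dxx (T, K))
    (t x : Ioi (0 : ℝ)) : f.dt (t, x) = σ t x ^ 2 / 2 * f.dxx (t, x) := by
  have hcσ : Continuous fun p : Ioi (0 : ℝ) × Ioi (0 : ℝ) => σ p.1 p.2 :=
    hσ.continuousOn.comp_continuous
      (f := fun p : Ioi (0 : ℝ) × Ioi (0 : ℝ) => ((p.1 : ℝ), (p.2 : ℝ))) (by fun_prop)
      fun p => ⟨le_of_lt (mem_Ioi.1 p.1.2), p.2.2⟩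
  have key : ∀ ε : ℝ, ε * (σ t x ^ 2 / 2 * f.dxx (t, x)) ≤ ε * f.dt (t, x) := by
    intro ε
    by_contra! hlt
    obtain ⟨v, hv, hv'⟩ := exists_between hlt
    obtain ⟨u, hu, hu'⟩ := exists_between hv'
    have h1 : ∀ᶠ p in 𝓝 (t, x), ε * f.dt p < v :=
      (continuous_const.mul f.dt.continuous).continuousAt.eventually (gt_mem_nhds hv)
    have h2 : ∀ᶠ p : Ioi (0 : ℝ) × Ioi (0 : ℝ) in 𝓝 (t, x),
        u < ε * (σ p.1 p.2 ^ 2 / 2 * f.dxx p) :=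
      (continuous_const.mul (((hcσ.pow 2).div_const 2).mul
        f.dxx.continuous)).continuousAt.eventually (lt_mem_nhds hu')
    obtain ⟨r, hr, hball⟩ := Metric.eventually_nhds_iff.1 (h1.and h2)
    have hx : (0 : ℝ) < x := x.2
    set δ := min r x / 2 with hδ
    have hm := lt_min hr hx
    have hδ0 : 0 < δ := by positivity
    have hδr : δ < r := by have := min_le_left r (x : ℝ); linarith
    have hδx : δ < x := by have := min_le_right r (x : ℝ); linarith
    have hmem : ∀ s y : Ioi (0 : ℝ), (s : ℝ) ∈ Icc (t : ℝ) (t + δ) →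
        (y : ℝ) ∈ Icc (x - δ : ℝ) (x + δ) → dist (s, y) (t, x) < r := by
      intro s y hs hy
      refine lt_of_le_of_lt ?_ hδr
      rw [Prod.dist_eq, max_le_iff, Subtype.dist_eq, Subtype.dist_eq, Real.dist_eq, Real.dist_eq,
        abs_le, abs_le]
      exact ⟨⟨by linarith [hs.1], by linarith [hs.2]⟩, ⟨by linarith [hy.1], by linarith [hy.2]⟩⟩
    exact hu.not_ge (dupire_aux hσ hf hdxx t.2 (by linarith : (t : ℝ) < t + δ) hδ0 hδx
      (fun s y hs hy => (hball (hmem s y hs hy)).1.le)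
      (fun s y hs hy => (hball (hmem s y hs hy)).2.le))
  have h1 := key 1
  have h2 := key (-1)
  linarith

lemma impliedVol_eq {x₀ : ℝ} {f : PriceSurface} {σ : ℝ → ℝ → ℝ} (hσ : IsAdmissibleVol σ)
    (hf : IsCallSurface 1 x₀ σ f) (hdxx : ∀ T K : Ioi (0 : ℝ), 0 < f.dxx (T, K))
    (t x : Ioi (0 : ℝ)) : impliedVol f t x = σ t x := by
  have h0 : 0 ≤ σ t x := (hσ.pos t x (le_of_lt t.2) x.2).le
  rw [impliedVol, dupire hσ hf hdxx, ← Real.sqrt_sq h0]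
  congr 1
  have := (hdxx t x).ne'
  rw [Real.sqrt_sq h0]
  field_simp

/-! ### Local maxima of a piecewise monotone volatility -/

/-- The integral `∫_c^∞ x ∂_{xx} f(t,x) / ∂_t f(t,x) dx`. -/
def tailIntegral (c : ℝ) (f : PriceSurface) (t : Ioi (0 : ℝ)) : ℝ≥0∞ :=
  ∫⁻ x in Ioi c, ENNReal.ofReal (onPos (fun y => y * f.dxx (t, y) / f.dt (t, y)) x)

section PiecewiseMonotone

variable {σ : ℝ → ℝ → ℝ}

lemma IsPiecewiseMonotoneInTime.exists_right (hσ : IsPiecewiseMonotoneInTime σ) {t : ℝ}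
    (ht : 0 ≤ t) : ∃ r, t < r ∧
      ((∀ x, 0 < x → MonotoneOn (fun t => σ t x) (Icc t r)) ∨
        (∀ x, 0 < x → AntitoneOn (fun t => σ t x) (Icc t r))) := by
  classical
  obtain ⟨τ, h0, -, hlim, hτ⟩ := hσ
  have hex : ∃ n, t < τ n := (hlim.eventually_gt_atTop t).exists
  obtain ⟨n, hn⟩ : ∃ n, Nat.find hex = n + 1 :=
    Nat.exists_eq_succ_of_ne_zero fun h => by
      have := Nat.find_spec hex
      rw [h, h0] at this
      exact this.not_ge ht
  have h1 : t < τ (n + 1) := hn ▸ Nat.find_spec hex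
  have h2 : τ n ≤ t := not_lt.1 (Nat.find_min hex (by lia))
  exact ⟨τ (n + 1), h1, (hτ n).imp (fun h x hx => (h x hx).mono (Icc_subset_Icc_left h2))
    fun h x hx => (h x hx).mono (Icc_subset_Icc_left h2)⟩

lemma IsPiecewiseMonotoneInTime.exists_left (hσ : IsPiecewiseMonotoneInTime σ) {t : ℝ}
    (ht : 0 < t) : ∃ l, 0 ≤ l ∧ l < t ∧
      ((∀ x, 0 < x → MonotoneOn (fun t => σ t x) (Icc l t)) ∨
        (∀ x, 0 < x → AntitoneOn (fun t => σ t x) (Icc l t))) := by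
  classical
  obtain ⟨τ, h0, hmono, hlim, hτ⟩ := hσ
  have hex : ∃ n, t ≤ τ n := (hlim.eventually_ge_atTop t).exists
  obtain ⟨n, hn⟩ : ∃ n, Nat.find hex = n + 1 :=
    Nat.exists_eq_succ_of_ne_zero fun h => by
      have := Nat.find_spec hex
      rw [h, h0] at this
      exact this.not_gt ht
  have h1 : t ≤ τ (n + 1) := hn ▸ Nat.find_spec hex
  have h2 : τ n < t := not_le.1 (Nat.find_min hex (by lia))
  exact ⟨τ n, h0 ▸ hmono.monotone (Nat.zero_le n), h2,
    (hτ n).imp (fun h x hx => (h x hx).mono (Icc_subset_Icc_right h1))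
    fun h x hx => (h x hx).mono (Icc_subset_Icc_right h1)⟩

/-- Next to a time which is not a strict local maximum the volatility is at least as large. -/
lemma exists_Ioo_le_of_notMem_localMaxTimes (hσ : IsPiecewiseMonotoneInTime σ) {f : PriceSurface}
    (hf : ∀ t x : Ioi (0 : ℝ), impliedVol f t x = σ t x) {t : Ioi (0 : ℝ)}
    (ht : t ∉ localMaxTimes f) :
    ∃ a b : ℝ, 0 < a ∧ a < b ∧ ∀ s : Ioi (0 : ℝ), (s : ℝ) ∈ Ioo a b →
      impliedVol f t ≤ impliedVol f s := by
  have ht0 : (0 : ℝ) < t := t.2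
  obtain ⟨r, htr, hr⟩ := hσ.exists_right ht0.le
  obtain ⟨l, hl0, hlt, hl⟩ := hσ.exists_left ht0
  rcases hl with hl | hl
  · rcases hr with hr | hr
    · refine ⟨t, r, ht0, htr, fun s hs x => ?_⟩
      rw [hf, hf]
      exact hr x x.2 ⟨le_rfl, htr.le⟩ ⟨hs.1.le, hs.2.le⟩ hs.1.le
    -- Increasing before `t` and decreasing after, the volatility has a weak maximum at `t`. Failure
    -- of strictness gives a nearby `s` with the same volatility, and monotonicity makes it constant
    -- between `s` and `t`.
    · have hfreq : ∃ᶠ s in 𝓝[≠] t, ¬ impliedVol f s < impliedVol f t :=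
        not_eventually.1 ht
      have hnhds : ∀ᶠ s : Ioi (0 : ℝ) in 𝓝[≠] t, s ≠ t ∧ (s : ℝ) ∈ Ioo l r :=
        (eventually_mem_nhdsWithin (a := t) (s := {t}ᶜ)).and (nhdsWithin_le_nhds
          (continuous_subtype_val.continuousAt.eventually (Ioo_mem_nhds hlt htr)))
      obtain ⟨s, hs, hst, hsl, hsr⟩ := (hfreq.and_eventually hnhds).exists
      have hle : impliedVol f s ≤ impliedVol f t := by
        intro x
        rw [hf, hf]
        rcases le_total (s : ℝ) t with h | h
        · exact hl x x.2 ⟨hsl.le, h⟩ ⟨hlt.le, le_rfl⟩ h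
        · exact hr x x.2 ⟨le_rfl, htr.le⟩ ⟨h, hsr.le⟩ h
      have heq : impliedVol f s = impliedVol f t := by
        by_contra hne
        exact hs (lt_of_le_of_ne hle hne)
      rcases lt_or_gt_of_ne hst with h | h
      · refine ⟨s, t, s.2, h, fun u hu x => ?_⟩
        rw [← heq, hf, hf]
        exact hl x x.2 ⟨hsl.le, le_of_lt h⟩ ⟨(hsl.trans hu.1).le, hu.2.le⟩ hu.1.le
      · refine ⟨t, s, ht0, h, fun u hu x => ?_⟩
        rw [← heq, hf, hf]
        exact hr x x.2 ⟨hu.1.le, (hu.2.trans hsr).le⟩ ⟨le_of_lt h, hsr.le⟩ hu.2.le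
  -- The midpoint replaces `l`, which may be `0`, to keep the left endpoint positive.
  · refine ⟨(l + t) / 2, t, by linarith, by linarith, fun s hs x => ?_⟩
    rw [hf, hf]
    exact hl x x.2 ⟨by linarith [hs.1], hs.2.le⟩ ⟨hlt.le, le_rfl⟩ hs.2.le

/-- An interior point of a monotone piece is not a strict local maximum: on one side of it the
volatility is at least as large. -/
lemma exists_rat_notMem_localMaxTimes (hσ : IsPiecewiseMonotoneInTime σ) {f : PriceSurface}
    (hf : ∀ t x : Ioi (0 : ℝ), impliedVol f t x = σ t x) {a b : ℝ} (ha : 0 < a) (hab : a < b) :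
    ∃ (q : ℚ) (hq : 0 < (q : ℝ)), (q : ℝ) ∈ Ioo a b ∧ (⟨q, hq⟩ : Ioi (0 : ℝ)) ∉ localMaxTimes f := by
  obtain ⟨r, har, hr⟩ := hσ.exists_right ha.le
  obtain ⟨q, haq, hq⟩ := exists_rat_btwn (lt_min har hab)
  have hqr : (q : ℝ) < r := hq.trans_le (min_le_left _ _)
  have hq0 : 0 < (q : ℝ) := ha.trans haq
  refine ⟨q, hq0, ⟨haq, hq.trans_le (min_le_right _ _)⟩, fun hmem => ?_⟩
  have hmem' : ∀ᶠ s in 𝓝[≠] (⟨q, hq0⟩ : Ioi (0 : ℝ)), impliedVol f s < impliedVol f ⟨q, hq0⟩ := hmem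
  rw [eventually_nhdsWithin_iff, Metric.eventually_nhds_iff] at hmem'
  obtain ⟨η, hη, hball⟩ := hmem'
  rcases hr with hr | hr
  · obtain ⟨s, hqs, hs⟩ := exists_between (lt_min hqr (by linarith : (q : ℝ) < q + η))
    have hsr : s < r := hs.trans_le (min_le_left _ _)
    have hsη : s < q + η := hs.trans_le (min_le_right _ _)
    have hs0 : 0 < s := hq0.trans hqs
    refine (hball (y := ⟨s, hs0⟩) ?_ ?_).not_ge fun x => ?_
    · rw [Subtype.dist_eq, Real.dist_eq, abs_of_pos (sub_pos.2 hqs)]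
      linarith
    · exact fun h => hqs.ne' (congrArg Subtype.val h)
    · rw [hf, hf]
      exact hr x x.2 ⟨haq.le, hqr.le⟩ ⟨(haq.trans hqs).le, hsr.le⟩ hqs.le
  · obtain ⟨s, hs, hqs⟩ := exists_between (max_lt haq (by linarith : (q : ℝ) - η < q))
    have has : a < s := (le_max_left _ _).trans_lt hs
    have hsη : q - η < s := (le_max_right _ _).trans_lt hs
    have hs0 : 0 < s := ha.trans has
    refine (hball (y := ⟨s, hs0⟩) ?_ ?_).not_ge fun x => ?_
    · rw [Subtype.dist_eq, Real.dist_eq, abs_of_neg (sub_neg.2 hqs)]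
      linarith
    · exact fun h => hqs.ne (congrArg Subtype.val h)
    · rw [hf, hf]
      exact hr x x.2 ⟨has.le, (hqs.trans hqr).le⟩ ⟨haq.le, hqr.le⟩ hqs.le

end PiecewiseMonotone

/-! ### The bubble criterion for `α = 1` -/

section Tail

variable {f : PriceSurface}

/-- The cutoff is immaterial for finiteness: the integrand is continuous on the compact interval
`[c, C]`, away from zero. -/
lemma tailIntegral_lt_top (hdt : ∀ t x : Ioi (0 : ℝ), 0 < f.dt (t, x)) {c C : ℝ} (hc : 0 < c)
    {t : Ioi (0 : ℝ)} (h : tailIntegral C f t < ⊤) : tailIntegral c f t < ⊤ := by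
  set g := onPos fun y => y * f.dxx (t, y) / f.dt (t, y) with hg
  have hgc : ContinuousOn g (Ioi 0) := by
    refine continuousOn_onPos (Continuous.div ?_ ?_ fun y => (hdt t y).ne') <;> fun_prop
  have h1 : ∫⁻ x in Icc c C, ENNReal.ofReal (g x) < ⊤ :=
    ((hgc.mono fun y hy => hc.trans_le hy.1).integrableOn_Icc (μ := volume)).lintegral_lt_top
  refine lt_of_le_of_lt ?_ (ENNReal.add_lt_top.2 ⟨h1, h⟩)
  refine le_trans (lintegral_mono_set (fun x hx => ?_)) (lintegral_union_le _ (Icc c C) (Ioi C))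
  rcases le_or_gt x C with hxC | hxC
  · exact Or.inl ⟨le_of_lt hx, hxC⟩
  · exact Or.inr hxC

/-- The integrand equals `2x / impliedVol²`. -/
lemma tailIntegral_anti (hdt : ∀ t x : Ioi (0 : ℝ), 0 < f.dt (t, x))
    (hdxx : ∀ t x : Ioi (0 : ℝ), 0 < f.dxx (t, x)) (c : ℝ) {s t : Ioi (0 : ℝ)}
    (hst : impliedVol f t ≤ impliedVol f s) : tailIntegral c f s ≤ tailIntegral c f t := by
  refine lintegral_mono fun x => ENNReal.ofReal_le_ofReal ?_
  rcases le_or_gt x 0 with hx | hx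
  · simp [onPos, hx.not_gt]
  rw [onPos_of_pos _ hx, onPos_of_pos _ hx]
  have h1 := hst ⟨x, hx⟩
  have ht := hdt t ⟨x, hx⟩
  have hs := hdt s ⟨x, hx⟩
  have ht' := hdxx t ⟨x, hx⟩
  have hs' := hdxx s ⟨x, hx⟩
  rw [impliedVol, impliedVol, Real.sqrt_le_sqrt_iff (by positivity), div_le_div_iff₀ ht' hs'] at h1
  rw [div_le_div_iff₀ hs ht]
  simp only
  nlinarith

/-- Derivatives are local, so prices at strikes `x ≥ C` determine the strike derivatives for `x >
C`. -/
lemma tailIntegral_congr {f g : PriceSurface} {C : ℝ} (hC : 0 < C)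
    (h : ∀ (t : ℝ≥0) (x : Ioi (0 : ℝ)), C ≤ x → f.val (t, x) = g.val (t, x)) (t : Ioi (0 : ℝ)) :
    tailIntegral C f t = tailIntegral C g t := by
  have hdt : ∀ x : Ioi (0 : ℝ), C ≤ x → f.dt (t, x) = g.dt (t, x) := by
    intro x hx
    have h1 := f.hasDerivAt_t t x
    simp only [h _ x hx] at h1
    exact h1.unique (g.hasDerivAt_t t x)
  have hdx : ∀ x : Ioi (0 : ℝ), C < x → f.dx (t, x) = g.dx (t, x) := by
    intro x hx
    refine (f.hasDerivAt_x t x).unique ((g.hasDerivAt_x t x).congr_of_eventuallyEq ?_)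
    filter_upwards [lt_mem_nhds hx] with y hy
    rw [onPos_of_pos _ (hC.trans hy), onPos_of_pos _ (hC.trans hy), h _ _ hy.le]
  have hdxx : ∀ x : Ioi (0 : ℝ), C < x → f.dxx (t, x) = g.dxx (t, x) := by
    intro x hx
    refine (f.hasDerivAt_xx t x).unique ((g.hasDerivAt_xx t x).congr_of_eventuallyEq ?_)
    filter_upwards [lt_mem_nhds hx] with y hy
    rw [onPos_of_pos _ (hC.trans hy), onPos_of_pos _ (hC.trans hy)]
    exact hdx ⟨y, hC.trans hy⟩ hy
  refine setLIntegral_congr_fun measurableSet_Ioi fun x hx => ?_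
  have hx0 : 0 < x := hC.trans hx
  simp only [onPos_of_pos _ hx0]
  rw [hdt ⟨x, hx0⟩ (le_of_lt hx), hdxx ⟨x, hx0⟩ hx]

/-- The bubble criterion for `α = 1` in terms of countably many tail integrals. -/
lemma bubbleAtInfinity_iff {x₀ c C : ℝ} (hc : 0 < c) (hC : 0 < C)
    (hf : f ∈ callSurfaces 1 x₀) :
    BubbleAtInfinity c f ↔ ∃ a b : ℚ, 0 < (a : ℝ) ∧ (a : ℝ) < b ∧
      ∀ q : {q : ℚ // 0 < (q : ℝ)}, ((q : ℚ) : ℝ) ∈ Ioo (a : ℝ) b →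
        tailIntegral C f ⟨(q : ℚ), q.2⟩ < ⊤ := by
  obtain ⟨⟨σ, hσ, hmono, hf⟩, hdxx⟩ := hf
  have hdt : ∀ t x : Ioi (0 : ℝ), 0 < f.dt (t, x) := by
    intro t x
    rw [dupire hσ hf hdxx]
    have := hσ.pos t x (le_of_lt t.2) x.2
    have := hdxx t x
    positivity
  have hvol := impliedVol_eq hσ hf hdxx
  constructor
  · rintro ⟨t, ht, hfin⟩
    obtain ⟨a, b, ha, hab, h⟩ := exists_Ioo_le_of_notMem_localMaxTimes hmono hvol ht
    obtain ⟨a', haa', ha'b⟩ := exists_rat_btwn hab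
    obtain ⟨b', ha'b', hb'b⟩ := exists_rat_btwn ha'b
    refine ⟨a', b', ha.trans haa', ha'b', fun q hq => ?_⟩
    refine lt_of_le_of_lt (tailIntegral_anti hdt hdxx C (h _ ⟨haa'.trans hq.1, hq.2.trans hb'b⟩)) ?_
    exact tailIntegral_lt_top hdt hC hfin
  · rintro ⟨a, b, ha, hab, h⟩
    obtain ⟨q, hq0, hq, hqn⟩ := exists_rat_notMem_localMaxTimes hmono hvol ha hab
    exact ⟨⟨q, hq0⟩, hqn, tailIntegral_lt_top hdt hc (h ⟨q, hq0⟩ hq)⟩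

end Tail

/-! ### Measurability of the bubble indicator -/

section Topology

lemma continuous_priceSurface_fields :
    Continuous fun f : PriceSurface => (f.val, f.dt, f.dx, f.dxx) := continuous_induced_dom

instance : LocallyCompactSpace (Ioi (0 : ℝ)) := isOpen_Ioi.locallyCompactSpace

lemma continuous_val : Continuous PriceSurface.val := continuous_priceSurface_fields.fst

lemma continuous_dt : Continuous PriceSurface.dt := continuous_priceSurface_fields.snd.fst

lemma continuous_dxx : Continuous PriceSurface.dxx := continuous_priceSurface_fields.snd.snd.snd

/-- Second countability gives the product with `ℝ` its Borel structure in `measurable_tailIntegral`,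
and lets the support of `μ` carry full measure. -/
instance : SecondCountableTopology PriceSurface :=
  (Topology.IsInducing.mk (f := fun f : PriceSurface => (f.val, f.dt, f.dx, f.dxx))
    rfl).secondCountableTopology

lemma continuous_val_apply (p : ℝ≥0 × Ioi (0 : ℝ)) : Continuous fun f : PriceSurface => f.val p :=
  (ContinuousEvalConst.continuous_eval_const p).comp continuous_val

lemma measurable_tailIntegral (c : ℝ) (t : Ioi (0 : ℝ)) :
    Measurable fun f => tailIntegral c f t := by
  have hm : Measurable fun p : PriceSurface × ℝ =>
      onPos (fun y => y * p.1.dxx (t, y) / p.1.dt (t, y)) p.2 := by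
    have hs : MeasurableSet {p : PriceSurface × ℝ | 0 < p.2} :=
      measurableSet_lt measurable_const measurable_snd
    have h1 : Continuous fun p : {p : PriceSurface × ℝ | 0 < p.2} =>
        p.1.1.dxx (t, (⟨p.1.2, p.2⟩ : Ioi (0 : ℝ))) :=
      (continuous_dxx.comp (continuous_fst.comp continuous_subtype_val)).eval
        (continuous_const.prodMk
          ((continuous_snd.comp continuous_subtype_val).subtype_mk fun p => p.2))
    have h2 : Continuous fun p : {p : PriceSurface × ℝ | 0 < p.2} =>
        p.1.1.dt (t, (⟨p.1.2, p.2⟩ : Ioi (0 : ℝ))) :=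
      (continuous_dt.comp (continuous_fst.comp continuous_subtype_val)).eval
        (continuous_const.prodMk
          ((continuous_snd.comp continuous_subtype_val).subtype_mk fun p => p.2))
    have h3 : Continuous fun p : {p : PriceSurface × ℝ | 0 < p.2} => (p.1.2 : ℝ) :=
      continuous_snd.comp continuous_subtype_val
    have h4 := ((h3.measurable.mul h1.measurable).div h2.measurable)
    exact Measurable.dite h4 measurable_const hs
  exact (ENNReal.measurable_ofReal.comp hm).lintegral_prod_right'

end Topology

lemma measurable_bubbleIndicator {α x₀ c : ℝ} (hα : α ≤ 1) (hc : 0 < c) :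
    Measurable (bubbleIndicator α x₀ c) := by
  classical
  rcases hα.lt_or_eq with h | rfl
  · have hF : bubbleIndicator α x₀ c = fun f => if BubbleAtZero x₀ f.1 then 1 else 0 := by
      funext f
      simp [bubbleIndicator, h]
    rw [hF]
    refine Measurable.ite ?_ measurable_const measurable_const
    simp only [fun f : callSurfaces α x₀ => bubbleAtZero_iff h f.2, ofPred_exists, ofPred_and,
      ofPred_forall]
    refine .iUnion fun n => .iUnion fun r => (MeasurableSet.const _).inter (.iInter fun k => ?_)
    exact measurableSet_le ((continuous_val_apply _).measurable.comp measurable_subtype_coe)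
      measurable_const
  · have hF : bubbleIndicator 1 x₀ c = fun f => if BubbleAtInfinity c f.1 then 1 else 0 := by
      funext f
      simp [bubbleIndicator]
    rw [hF]
    refine Measurable.ite ?_ measurable_const measurable_const
    simp only [fun f : callSurfaces 1 x₀ => bubbleAtInfinity_iff hc hc f.2, ofPred_exists,
      ofPred_and, ofPred_forall]
    refine .iUnion fun a => .iUnion fun b => (MeasurableSet.const _).inter
      ((MeasurableSet.const _).inter (.iInter fun q => .iInter fun _ => ?_))
    exact measurableSet_lt ((measurable_tailIntegral _ _).comp measurable_subtype_coe)
      measurable_const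

lemma bubbleIndicator_mem_Icc (α x₀ c : ℝ) (f : callSurfaces α x₀) :
    bubbleIndicator α x₀ c f ∈ Icc (0 : ℝ) 1 := by
  unfold bubbleIndicator
  split_ifs <;> simp

/-- The bubble indicator depends only on the prices in the observation set. -/
lemma bubbleIndicator_congr {α x₀ c ε C : ℝ} (hα : α ≤ 1) (hc : 0 < c) (hε : 0 < ε) (hC : 0 < C)
    {f g : callSurfaces α x₀} (h : EqOn f.1.val g.1.val (observationSet α ε C)) :
    bubbleIndicator α x₀ c f = bubbleIndicator α x₀ c g := by
  classical
  rcases hα.lt_or_eq with h1 | rfl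
  · have : BubbleAtZero x₀ f.1 ↔ BubbleAtZero x₀ g.1 := by
      have heq : ∀ T : ℝ≥0, (onPos fun x => f.1.val (T, x)) =ᶠ[𝓝[>] 0]
          onPos fun x => g.1.val (T, x) := by
        intro T
        filter_upwards [Ioc_mem_nhdsGT hε] with y hy
        rw [onPos_of_pos _ hy.1, onPos_of_pos _ hy.1]
        exact h (Or.inl ⟨h1, hy.2⟩)
      simp only [BubbleAtZero, fun (T : ℝ≥0) (l : ℝ) => tendsto_congr' (l₂ := 𝓝 l) (heq T)]
    simp only [bubbleIndicator, if_pos h1]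
    exact if_congr this rfl rfl
  · have : BubbleAtInfinity c f.1 ↔ BubbleAtInfinity c g.1 := by
      rw [bubbleAtInfinity_iff hc hC f.2, bubbleAtInfinity_iff hc hC g.2]
      simp only [fun t => tailIntegral_congr (f := f.1) (g := g.1) hC
        (fun t x hx => h (Or.inr ⟨rfl, hx⟩)) t]
    simp only [bubbleIndicator, lt_irrefl, if_false]
    exact if_congr this rfl rfl

/-! ### Averages over the matching surfaces -/

section Average

variable {α x₀ : ℝ} {F : callSurfaces α x₀ → ℝ} {ν : Measure (callSurfaces α x₀)}
  {P : ℕ → ℝ≥0 × Ioi (0 : ℝ)}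

lemma measurable_price (p : ℝ≥0 × Ioi (0 : ℝ)) :
    Measurable fun f : callSurfaces α x₀ => f.1.val p :=
  (continuous_val_apply p).measurable.comp measurable_subtype_coe

lemma measurableSet_matchingSurfaces (P : ℕ → ℝ≥0 × Ioi (0 : ℝ)) (n : ℕ) (c : Fin n → ℝ) :
    MeasurableSet (matchingSurfaces (α := α) (x₀ := x₀) P n c) := by
  simp only [matchingSurfaces, ofPred_forall]
  exact .iInter fun i => measurable_price _ (measurableSet_singleton _)

/-- Distinct price vectors have disjoint matching sets, and a finite measure charges only countably
many of these. The function is thus zero off a countable set. -/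
lemma measurable_averagedIndicator [IsFiniteMeasure ν] (n : ℕ) :
    Measurable (averagedIndicator F ν P n) := by
  have hcount : {v : Fin n → ℝ | 0 < ν (matchingSurfaces P n v)}.Countable := by
    refine Measure.countable_meas_pos_of_disjoint_iUnion
      (fun v => measurableSet_matchingSurfaces P n v) fun v w hvw => ?_
    refine disjoint_left.2 fun f hv hw => hvw (funext fun i => ?_)
    rw [← hv i, hw i]
  refine (measurable_const (a := (0 : ℝ))).measurable_of_countable_ne (hcount.mono fun v hv => ?_)
  by_contra h
  have h' : ¬ 0 < ν (matchingSurfaces P n v) := h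
  exact hv (by rw [averagedIndicator, if_neg h'])

lemma averagedIndicator_mem_Icc [IsFiniteMeasure ν] (hF : ∀ f, F f ∈ Icc (0 : ℝ) 1) (n : ℕ)
    (v : Fin n → ℝ) : averagedIndicator F ν P n v ∈ Icc (0 : ℝ) 1 := by
  rw [averagedIndicator]
  split_ifs with h
  · have h0 : 0 < (ν (matchingSurfaces P n v)).toReal :=
      ENNReal.toReal_pos h.ne' (measure_ne_top _ _)
    have h1 : 0 ≤ ∫ f in matchingSurfaces P n v, F f ∂ν := integral_nonneg fun f => (hF f).1
    have h2 : ∫ f in matchingSurfaces P n v, F f ∂ν ≤ (ν (matchingSurfaces P n v)).toReal := by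
      have := norm_setIntegral_le_of_norm_le_const (μ := ν) (s := matchingSurfaces P n v) (f := F)
        (C := 1) (measure_lt_top _ _) fun f _ => by
          rw [Real.norm_eq_abs, abs_of_nonneg (hF f).1]; exact (hF f).2
      rw [one_mul] at this
      exact (le_abs_self _).trans this
    refine ⟨by positivity, ?_⟩
    rw [inv_mul_le_iff₀ h0, mul_one]
    exact h2
  · simp

lemma tendsto_averagedIndicator [IsFiniteMeasure ν] (hFm : Measurable F)
    (hF : ∀ f, F f ∈ Icc (0 : ℝ) 1) {g : callSurfaces α x₀}
    (hg : 0 < ν {f : callSurfaces α x₀ | ∀ i : ℕ, f.1.val (P i) = g.1.val (P i)})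
    (hconst : ∀ f : callSurfaces α x₀, (∀ i : ℕ, f.1.val (P i) = g.1.val (P i)) → F f = F g) :
    Tendsto (fun n => averagedIndicator F ν P n fun i : Fin n => g.1.val (P i)) atTop
      (𝓝 (F g)) := by
  set s : ℕ → Set (callSurfaces α x₀) := fun n =>
    matchingSurfaces P n fun i : Fin n => g.1.val (P i) with hs
  set S := {f : callSurfaces α x₀ | ∀ i : ℕ, f.1.val (P i) = g.1.val (P i)} with hS
  have hsm : ∀ n, MeasurableSet (s n) := fun n => measurableSet_matchingSurfaces P n _
  have hanti : Antitone s := fun m n hmn f hf i => hf (i.castLE hmn)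
  have hinter : ⋂ n, s n = S := by
    ext f
    simp only [mem_iInter, hs, hS, matchingSurfaces, mem_ofPred_eq]
    -- The `i`-th observation is the last among the first `i + 1`.
    exact ⟨fun h i => h (i + 1) (Fin.last i), fun h n i => h i⟩
  have hSm : MeasurableSet S := hinter ▸ MeasurableSet.iInter hsm
  have hpos : ∀ n, 0 < ν (s n) := fun n =>
    hg.trans_le (measure_mono (hinter ▸ iInter_subset s n))
  have hint : Integrable F ν :=
    Integrable.mono' (integrable_const 1) hFm.aestronglyMeasurable (ae_of_all _ fun f => by
      rw [Real.norm_eq_abs, abs_of_nonneg (hF f).1]; exact (hF f).2)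
  have h1 : Tendsto (fun n => (ν (s n)).toReal) atTop (𝓝 (ν S).toReal) := by
    refine (ENNReal.tendsto_toReal (measure_ne_top _ _)).comp ?_
    rw [← hinter]
    exact tendsto_measure_iInter_atTop (fun n => (hsm n).nullMeasurableSet) hanti
      ⟨0, measure_ne_top _ _⟩
  have h2 : Tendsto (fun n => ∫ f in s n, F f ∂ν) atTop (𝓝 (∫ f in S, F f ∂ν)) := by
    rw [← hinter]
    exact tendsto_setIntegral_of_antitone hsm hanti ⟨0, hint.integrableOn⟩
  have h3 : ∫ f in S, F f ∂ν = (ν S).toReal * F g := by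
    rw [setIntegral_congr_fun hSm fun f hf => hconst f hf]
    simp [measureReal_def]
  have h0 : (ν S).toReal ≠ 0 := (ENNReal.toReal_pos hg.ne' (measure_ne_top _ _)).ne'
  have h4 := (h1.inv₀ h0).mul h2
  rw [h3, inv_mul_cancel_left₀ h0] at h4
  refine h4.congr fun n => ?_
  rw [averagedIndicator, if_pos (hpos n)]

end Average

end

end BubbleDetection

/-! ### The convergence theorem -/

open BubbleDetection in
theorem mainTheorem3 (α x₀ c ε C : ℝ) (hα : α ∈ Set.Icc (0 : ℝ) 1) (hx₀ : 0 < x₀) (hc : 0 < c)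
    (hε : 0 < ε) (hC : 0 < C)
    (P : ℕ → ℝ≥0 × Set.Ioi (0 : ℝ))
    (hP : BubbleDetection.observationSet α ε C ⊆ closure (Set.range P))
    (μ ν : Measure (BubbleDetection.callSurfaces α x₀))
    (hμ : IsProbabilityMeasure μ) (hν : IsProbabilityMeasure ν)
    (hpos : ∀ g ∈ μ.support,
      0 < ν {f : BubbleDetection.callSurfaces α x₀ | ∀ i : ℕ, f.1.val (P i) = g.1.val (P i)}) :
    let F := BubbleDetection.bubbleIndicator α x₀ c
    let Fn := BubbleDetection.averagedIndicator F ν P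
    Measurable F ∧
    (∀ n, Measurable (Fn n)) ∧
    (∀ n v, Fn n v ∈ Set.Icc (0 : ℝ) 1) ∧
    ∀ p : ℝ, 1 ≤ p →
      (∀ n, Integrable (fun g : BubbleDetection.callSurfaces α x₀ =>
        |Fn n (fun i : Fin n => g.1.val (P i)) - F g| ^ p) μ) ∧
      Tendsto (fun n => ∫ g : BubbleDetection.callSurfaces α x₀,
        |Fn n (fun i : Fin n => g.1.val (P i)) - F g| ^ p ∂μ) atTop (𝓝 0) := by
  intro F Fn
  have hF : ∀ f, F f ∈ Icc (0 : ℝ) 1 := bubbleIndicator_mem_Icc α x₀ c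
  have hFm : Measurable F := measurable_bubbleIndicator hα.2 hc
  have hFn : ∀ n v, Fn n v ∈ Icc (0 : ℝ) 1 := averagedIndicator_mem_Icc hF
  have hFnm : ∀ n, Measurable (Fn n) := measurable_averagedIndicator
  refine ⟨hFm, hFnm, hFn, fun p hp => ?_⟩
  have hp0 : 0 < p := one_pos.trans_le hp
  have hm : ∀ n, AEStronglyMeasurable (fun g : callSurfaces α x₀ =>
      |Fn n (fun i : Fin n => g.1.val (P i)) - F g| ^ p) μ := fun n =>
    Measurable.aestronglyMeasurable <| by
      have h1 : Measurable fun g : callSurfaces α x₀ => Fn n fun i : Fin n => g.1.val (P i) :=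
        (hFnm n).comp (measurable_pi_lambda _ fun i => measurable_price _)
      exact (measurable_norm.comp (h1.sub hFm)).pow_const p
  have hb : ∀ n (g : callSurfaces α x₀),
      ‖|Fn n (fun i : Fin n => g.1.val (P i)) - F g| ^ p‖ ≤ 1 := by
    intro n g
    have h1 := hFn n fun i : Fin n => g.1.val (P i)
    have h2 := hF g
    rw [Real.norm_eq_abs, abs_of_nonneg (by positivity)]
    refine Real.rpow_le_one (abs_nonneg _) (abs_le.2 ⟨?_, ?_⟩) hp0.le
    · linarith [h1.1, h2.2]
    · linarith [h1.2, h2.1]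
  refine ⟨fun n => Integrable.mono' (integrable_const 1) (hm n) (ae_of_all _ (hb n)), ?_⟩
  have hlim := tendsto_integral_of_dominated_convergence (μ := μ) (fun _ => (1 : ℝ)) hm
    (integrable_const 1) (fun n => ae_of_all _ (hb n)) (f := fun _ => (0 : ℝ)) ?_
  · simpa using hlim
  filter_upwards [Measure.support_mem_ae (μ := μ)] with g hg
  have hlim : Tendsto (fun n => Fn n fun i : Fin n => g.1.val (P i)) atTop (𝓝 (F g)) := by
    refine tendsto_averagedIndicator hFm hF (hpos g hg) fun f hf => ?_
    refine bubbleIndicator_congr hα.2 hc hε hC ?_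
    -- Equality at the observed points extends to their closure by continuity of the price surfaces.
    refine EqOn.mono hP (EqOn.closure ?_ f.1.val.continuous g.1.val.continuous)
    rintro _ ⟨i, rfl⟩
    exact hf i
  have h1 := ((hlim.sub_const (F g)).abs).rpow_const (p := p) (Or.inr hp0.le)
  simpa [Real.zero_rpow hp0.ne'] using h1
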